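/- **Theorem.** Consider $\min_{x\in\mathbb R^n} f(x)=\frac1N\sum_{i=1}^N f_i(x)$ subject to $c(x)=0$, with $f_i:\mathbb R^n\to\mathbb R$ and $c:\mathbb R^n\to\mathbb R^m$ ($m\le n$) twice continuously differentiable (the deterministic problem is the case of full samples). Write $J(x)$ for the Jacobian of $c$, $J_k=J(x_k)$, $c_k=c(x_k)$, $\mathcal L(x,y)=f(x)+y^Tc(x)$, $w=(x,y)$; unmarked norms are Euclidean/spectral. *Algorithm.* Parameters: $\eta,\sigma,\epsilon_\tau,\nu_\alpha,\nu_\gamma\in(0,1)$, $\tau_{-1},\gamma_0>0$; arbitrary $(x_0,y_0)$. At iteration $k$, take arbitrary nonempty samples $S_k^f,S_k^g,S_k^H\subseteq\{1,\dots,N\}$, and let $\bar f_k(x)=\frac1{|S_k^f|}\sum_{i\in S_k^f}f_i(x)$, $\bar g_k=\frac1{|S_k^g|}\sum_{i\in S_k^g}\nabla f_i(x_k)$, $\bar H_k=\frac1{|S_k^H|}\sum_{i\in S_k^H}\nabla^2f_i(x_k)$, $\bar W_k=\bar H_k+\sum_i y_{k,i}\nabla^2c_i(x_k)$. Solve $$\bar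 M_k\begin{bmatrix}\bar d_k\\ \bar\delta_k\end{bmatrix}=-\begin{bmatrix}\bar g_k+J_k^Ty_k\\ c_k\end{bmatrix},\qquad \bar M_k=\begin{bmatrix}\bar W_k&J_k^T\\J_k&0\end{bmatrix}.$$ Put $q_k=\bar g_k^T\bar d_k+\max\{\bar d_k^T\bar W_k\bar d_k,0\}$, $\tau_k^{trial}=\infty$ if $q_k\le0$ and $\tau_k^{trial}=(1-\sigma)\|c_k\|_1/q_k$ otherwise; $\bar\tau_k=\bar\tau_{k-1}$ if $\bar\tau_{k-1}\le\tau_k^{trial}$ and $\bar\tau_k=(1-\epsilon_\tau)\tau_k^{trial}$ otherwise (with $\bar\tau_{-1}=\tau_{-1}$). Let $\bar\phi_k(x)=\bar\tau_k\bar f_k(x)+\|c(x)\|_1$, $\Delta l_k=-\bar\tau_k\bar g_k^T\bar d_k+\|c_k\|_1$, $\epsilon_{f_k}=2\frac{N-|S_k^f|}N(\kappa_0+\mu_0\kappa_f)$, $\epsilon_{g_k}=2\frac{N-|S_k^g|}N(\kappa_1+\mu_1\kappa_g)$ and $$\epsilon_{A_k}=\bar\tau_k\big(\kappa_{J^\dagger}\kappa_c+\zeta^{-1}(\kappa_g+\epsilon_{g_k}+\kappa_W\kappa_{J^\dagger}\kappa_c)\big)\epsilon_{g_k}+2\bar\tau_k\epsilon_{f_k}.$$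 The classical condition for $\alpha$ is $\bar\phi_k(x_k+\alpha\bar d_k)\le\bar\phi_k(x_k)-\eta\alpha\Delta l_k+\epsilon_{A_k}$; the modified condition adds $\frac12\alpha^2\bar\tau_k\bar d_k^T\bar H_k\bar d_k+\frac12\alpha^2\sum_i|\bar d_k^T\nabla^2c_i(x_k)\bar d_k|$ to its right-hand side. If $\|\bar d_k\|>\gamma_k$, then $\bar\alpha_k$ is the first of $1,\nu_\alpha,\nu_\alpha^2,\dots$ satisfying the classical condition and $\gamma_{k+1}=\gamma_k$. If $\|\bar d_k\|\le\gamma_k$ and $\alpha=1$ satisfies the classical condition, then $\bar\alpha_k=1$ and $\gamma_{k+1}=\gamma_k$. Otherwise $\bar\alpha_k$ is the first of $1,\nu_\alpha,\nu_\alpha^2,\dots$ satisfying the modified condition and $\gamma_{k+1}=\nu_\gamma\gamma_k$. Set $x_{k+1}=x_k+\bar\alpha_k\bar d_k$, $y_{k+1}=y_k+\bar\delta_k$, $w_k=(x_k,y_k)$. *Assumptions.* 1. There is an open convex set $\mathcal X$ containing all $x_k$ and $x_k+\bar d_k$ on which $|f|\le\kappa_f$, $\|\nabla f\|\le\kappa_g$,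 $\|\nabla^2f\|\le\kappa_H$, $\|c\|\le\kappa_c$, $J$ is bounded, and $\nabla f$, $\nabla^2f$, $J$, $\nabla^2c_i$ are Lipschitz continuous; the $m$ singular values of $J(x)$ are bounded away from zero on $\mathcal X$, and $\|(J_kJ_k^T)^{-1}J_k\|\le\kappa_{J^\dagger}$ for all $k$. 2. $w^*=(x^*,y^*)$ satisfies $\nabla_x\mathcal L(x^*,y^*)=0$, $c(x^*)=0$, and in some ball around $w^*$ the gradient and the Hessian of $\mathcal L$ (in $w$) are Lipschitz continuous with constants $L_{\nabla\mathcal L},L_W>0$. 3. There are $\kappa_0,\mu_0,\kappa_1,\mu_1,\kappa_2,\mu_2>0$ such that for all $x\in\mathcal X$ and all $i$: $|f_i(x)|\le\kappa_0+\mu_0|f(x)|$, $\|\nabla f_i(x)\|\le\kappa_1+\mu_1\|\nabla f(x)\|$, $\|\nabla^2f_i(x)\|\le\kappa_2+\mu_2\|\nabla^2f(x)\|$. 4. There are $\kappa_W,\zeta,\Lambda,\kappa_M>0$ such that for all $k$: $\|\bar W_k\|\le\kappa_W$; $u^T\bar W_ku\ge\zeta\|u\|^2$ whenever $J_ku=0$;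 $\bar M_k$ is invertible with $\|\bar M_k^{-1}\|\le\Lambda$ and $\|\bar M_k\|\le\kappa_M$. 5. There are $\kappa_d,\mu_M>0$ such that, for every $k$ for which the solution $(d_k,\delta_k)$ of the same linear system at $(x_k,y_k)$ with the exact $\nabla f(x_k)$, $\nabla^2f(x_k)$ satisfies $\|d_k\|\le\kappa_d$, one has $\frac{\mu_M}2\|w_k-w^*\|\le\left\|\begin{bmatrix}\nabla f(x_k)+J_k^Ty_k\\c_k\end{bmatrix}\right\|$. *Conclusion.* There is a constant $\kappa_l>0$ with $\Delta l_k\ge\kappa_l\bar\tau_k\|\bar d_k\|^2$ for all $k$. Moreover, for every such $\kappa_l$, suppose that * (i) $\sum_k\frac{N-|S_k^f|}N<\infty$; (ii) $\sum_k\frac{N-|S_k^g|}N<\infty$; * (iii) for some $\bar\epsilon_H<2(1-\eta)\kappa_l$ and all $k$, $|S_k^H|\ge\big(1-\frac{\bar\epsilon_H}{2(\kappa_2+\mu_2\kappa_H)}\big)N$; and that for some $\hat k\in\mathbb N$: * (iv) for some $\kappa_w>0$ and some strictly decreasing sequence $\beta_t\to0$ with $\beta_1\le\rho_0^4$, for all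 $k\ge\hat k$ and $t=k-\hat k$, $|S_k^g|\ge\Big(1-\frac{\kappa_w\rho_0\beta_t^{t/2}}{4\Lambda(\kappa_1+\mu_1\kappa_g)}\Big)N$, where $\rho_0=\min\Big\{\nu_\gamma,\frac{\nu_\gamma^2\mu_M}{4\kappa_M(1+2\kappa_{J^\dagger}\kappa_W)\max\{2\Lambda L_{\nabla\mathcal L},\nu_\gamma\}},\frac{\mu_M\Lambda}2\Big\}$; * (v) for all $k\ge\hat k$, $|S_{k+1}^H|>|S_k^H|$ or $|S_{k+1}^H|=N$; $\lim_k|S_k^H|=N$; and $|S_{\hat k}^H|\ge\max\Big\{\frac{8\Lambda(\kappa_2+\mu_2\kappa_H)-\rho_0}{8\Lambda(\kappa_2+\mu_2\kappa_H)}N,1\Big\}$. Then $w_k\to w^*$ at an R-superlinear rate, i.e. $w_k\to w^*$ and there is a positive sequence $\xi_k$ with $\|w_k-w^*\|\le\xi_k$ for all $k$ and $\xi_{k+1}/\xi_k\to0$; and there is $k_1$ with $\bar\alpha_k=1$ for all $k\ge k_1$. -/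

import Mathlib

open Filter Topology

noncomputable section

namespace ModifiedSQP

/-- `ℝⁿ` with the Euclidean norm. -/
abbrev Vec (n : ℕ) := EuclideanSpace ℝ (Fin n)

/-- The primal-dual space `ℝⁿ⁺ᵐ`, written as `ℝⁿ × ℝᵐ` with the Euclidean norm
`‖(x, y)‖ = (‖x‖² + ‖y‖²)^{1/2}`. -/
abbrev PrimalDual (n m : ℕ) := WithLp 2 (Vec n × Vec m)

/-- The primal-dual vector with components `x` and `y`. -/
def pd {n m : ℕ} (x : Vec n) (y : Vec m) : PrimalDual n m := WithLp.toLp 2 (x, y)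

/-- The `ℓ₁` norm. -/
def l1Norm {m : ℕ} (v : Vec m) : ℝ := ∑ i, |v i|

/-- The Hessian of a real function, as an operator. -/
def hess {E : Type*} [NormedAddCommGroup E] [InnerProductSpace ℝ E] [CompleteSpace E]
    (f : E → ℝ) (x : E) : E →L[ℝ] E := fderiv ℝ (gradient f) x

/-- Data of the finite-sum problem `min (1/N) ∑ i, fᵢ(x)` subject to `c(x) = 0`, with twice
continuously differentiable `fᵢ : ℝⁿ → ℝ` and `c : ℝⁿ → ℝᵐ`. -/
structure Problem (n m N : ℕ) where
  /-- the component functions `fᵢ` -/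
  comp : Fin N → Vec n → ℝ
  /-- the constraint function `c` -/
  c : Vec n → Vec m
  comp_contDiff : ∀ i, ContDiff ℝ 2 (comp i)
  c_contDiff : ContDiff ℝ 2 c

namespace Problem

variable {n m N : ℕ} (P : Problem n m N)

/-- The objective `f = (1/N) ∑ i, fᵢ`. -/
def f (x : Vec n) : ℝ := (1 / (N : ℝ)) * ∑ i, P.comp i x

/-- The subsampled function value `(1/|S|) ∑ i ∈ S, fᵢ(x)`. -/
def fS (S : Finset (Fin N)) (x : Vec n) : ℝ := (1 / (S.card : ℝ)) * ∑ i ∈ S, P.comp i x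

/-- The subsampled gradient `(1/|S|) ∑ i ∈ S, ∇fᵢ(x)`. -/
def gS (S : Finset (Fin N)) (x : Vec n) : Vec n :=
  (1 / (S.card : ℝ)) • ∑ i ∈ S, gradient (P.comp i) x

/-- The subsampled Hessian `(1/|S|) ∑ i ∈ S, ∇²fᵢ(x)`. -/
def HS (S : Finset (Fin N)) (x : Vec n) : Vec n →L[ℝ] Vec n :=
  (1 / (S.card : ℝ)) • ∑ i ∈ S, hess (P.comp i) x

/-- The Jacobian `J(x) : ℝⁿ → ℝᵐ` of the constraint. -/
def J (x : Vec n) : Vec n →L[ℝ] Vec m := fderiv ℝ P.c x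

/-- The transposed Jacobian `J(x)ᵀ : ℝᵐ → ℝⁿ`. -/
def Jt (x : Vec n) : Vec m →L[ℝ] Vec n := ContinuousLinearMap.adjoint (P.J x)

/-- The Hessian `∇²cᵢ(x)` of the `i`-th constraint. -/
def hessC (i : Fin m) (x : Vec n) : Vec n →L[ℝ] Vec n := hess (fun z => P.c z i) x

/-- The Lagrangian `L(x, y) = f(x) + yᵀ c(x)`. -/
def lagrangian (w : PrimalDual n m) : ℝ := P.f w.fst + inner ℝ w.snd (P.c w.fst)

/-- `H + ∑ i, yᵢ ∇²cᵢ(x)`: the Hessian in `x` of the Lagrangian when `H = ∇²f(x)`, and its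
subsampled version when `H` is a subsampled Hessian. -/
def lagHess (H : Vec n →L[ℝ] Vec n) (x : Vec n) (y : Vec m) : Vec n →L[ℝ] Vec n :=
  H + ∑ i, y i • P.hessC i x

/-- The matrix `[W, Jᵀ; J, 0]` with `J = J(x)`. -/
def kkt (W : Vec n →L[ℝ] Vec n) (x : Vec n) : PrimalDual n m →L[ℝ] PrimalDual n m :=
  let e := WithLp.prodContinuousLinearEquiv 2 ℝ (Vec n) (Vec m)
  e.symm.toContinuousLinearMap ∘L
    ((W ∘L ContinuousLinearMap.fst ℝ (Vec n) (Vec m)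
        + P.Jt x ∘L ContinuousLinearMap.snd ℝ (Vec n) (Vec m)).prod
      (P.J x ∘L ContinuousLinearMap.fst ℝ (Vec n) (Vec m))) ∘L
    e.toContinuousLinearMap

/-- `(x, y)` is a first-order primal-dual stationary point: `∇ₓL(x, y) = 0` and `c(x) = 0`. -/
def IsStationary (x : Vec n) (y : Vec m) : Prop :=
  gradient (fun z => P.lagrangian (pd z y)) x = 0 ∧ P.c x = 0

/-- The vector `(g + J(x)ᵀ y, c(x))`; it is `∇L(x, y)` when `g = ∇f(x)`. -/
def residual (g : Vec n) (x : Vec n) (y : Vec m) : PrimalDual n m :=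
  pd (g + P.Jt x y) (P.c x)

/-- The subsampled `ℓ₁` merit function `τ f_S(x) + ‖c(x)‖₁`. -/
def merit (S : Finset (Fin N)) (x : Vec n) (τ : ℝ) : ℝ := τ * P.fS S x + l1Norm (P.c x)

/-- The reduction `-τ gᵀd + ‖c(x)‖₁` of the local model of the merit function. -/
def modelReduction (x : Vec n) (τ : ℝ) (g d : Vec n) : ℝ :=
  -τ * inner ℝ g d + l1Norm (P.c x)

end Problem

/-- The user parameters of the algorithm. -/
structure Params where
  η : ℝ
  σ : ℝ
  ετ : ℝ
  να : ℝ
  νγ : ℝ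
  /-- the initial merit parameter `τ₋₁` -/
  τinit : ℝ
  /-- the initial threshold `γ₀` -/
  γinit : ℝ
  η_mem : η ∈ Set.Ioo (0 : ℝ) 1
  σ_mem : σ ∈ Set.Ioo (0 : ℝ) 1
  ετ_mem : ετ ∈ Set.Ioo (0 : ℝ) 1
  να_mem : να ∈ Set.Ioo (0 : ℝ) 1
  νγ_mem : νγ ∈ Set.Ioo (0 : ℝ) 1
  τinit_pos : 0 < τinit
  γinit_pos : 0 < γinit

/-- The problem constants; what they bound is said in the assumptions below. -/
structure Constants where
  κf : ℝ
  κg : ℝ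
  κH : ℝ
  κc : ℝ
  /-- bound on `‖(J Jᵀ)⁻¹ J‖` -/
  κJ : ℝ
  κ₀ : ℝ
  μ₀ : ℝ
  κ₁ : ℝ
  μ₁ : ℝ
  κ₂ : ℝ
  μ₂ : ℝ
  κW : ℝ
  ζ : ℝ
  Λ : ℝ
  κM : ℝ
  /-- Lipschitz constant of `∇L` near the solution -/
  LgradL : ℝ
  /-- Lipschitz constant of `∇²L` near the solution -/
  LW : ℝ
  μM : ℝ
  κd : ℝ

namespace Constants

variable (K : Constants)

/-- The bound `ε_f` on the error of a subsampled function value. -/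
def εf {N : ℕ} (S : Finset (Fin N)) : ℝ :=
  2 * (((N : ℝ) - S.card) / N) * (K.κ₀ + K.μ₀ * K.κf)

/-- The bound `ε_g` on the error of a subsampled gradient. -/
def εg {N : ℕ} (S : Finset (Fin N)) : ℝ :=
  2 * (((N : ℝ) - S.card) / N) * (K.κ₁ + K.μ₁ * K.κg)

/-- The relaxation term `ε_A` of the line search, for the merit parameter `τ` and the function
and gradient samples `Sf`, `Sg`. -/
def εA {N : ℕ} (τ : ℝ) (Sf Sg : Finset (Fin N)) : ℝ :=
  τ * (K.κJ * K.κc + K.ζ⁻¹ * (K.κg + K.εg Sg + K.κW * K.κJ * K.κc)) * K.εg Sg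
    + 2 * τ * K.εf Sf

/-- The constant `ρ₀` in the sampling conditions. -/
def ρ₀ (p : Params) : ℝ :=
  min p.νγ (min
    (p.νγ ^ 2 * K.μM
      / (4 * K.κM * (1 + 2 * K.κJ * K.κW) * max (2 * K.Λ * K.LgradL) p.νγ))
    (K.μM * K.Λ / 2))

end Constants

/-- The trial value of the merit parameter; `curv` stands for `dᵀWd`, `gd` for `gᵀd`,
and `c1` for `‖c‖₁`. -/
def tauTrial (σ gd curv c1 : ℝ) : EReal :=
  if gd + max curv 0 ≤ 0 then ⊤ else (((1 - σ) * c1 / (gd + max curv 0) : ℝ) : EReal)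

/-- The update of the merit parameter from its previous value and the trial value. -/
def tauUpdate (ετ τprev : ℝ) (trial : EReal) : ℝ :=
  if (τprev : EReal) ≤ trial then τprev else (1 - ετ) * trial.toReal

/-- `α` is the result of backtracking from `1` with the factor `ν` until `cond` holds. -/
def IsBacktrack (ν : ℝ) (cond : ℝ → Prop) (α : ℝ) : Prop :=
  ∃ j : ℕ, α = ν ^ j ∧ cond (ν ^ j) ∧ ∀ i < j, ¬ cond (ν ^ i)

/-- All sequences that occur in a run of the algorithm. -/
structure Run (n m N : ℕ) where
  x : ℕ → Vec n
  y : ℕ → Vec m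
  d : ℕ → Vec n
  δ : ℕ → Vec m
  α : ℕ → ℝ
  τ : ℕ → ℝ
  γ : ℕ → ℝ
  Sf : ℕ → Finset (Fin N)
  Sg : ℕ → Finset (Fin N)
  SH : ℕ → Finset (Fin N)

namespace Run

variable {n m N : ℕ} (R : Run n m N) (P : Problem n m N)

/-- The primal-dual iterate `w_k = (x_k, y_k)`. -/
def w (k : ℕ) : PrimalDual n m := pd (R.x k) (R.y k)

/-- The gradient estimate at iteration `k`. -/
def g (k : ℕ) : Vec n := P.gS (R.Sg k) (R.x k)

/-- The Hessian estimate at iteration `k`. -/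
def H (k : ℕ) : Vec n →L[ℝ] Vec n := P.HS (R.SH k) (R.x k)

/-- The estimate of the Hessian of the Lagrangian at iteration `k`. -/
def W (k : ℕ) : Vec n →L[ℝ] Vec n := P.lagHess (R.H P k) (R.x k) (R.y k)

/-- The matrix of the linear system at iteration `k`. -/
def M (k : ℕ) : PrimalDual n m →L[ℝ] PrimalDual n m := P.kkt (R.W P k) (R.x k)

/-- The merit parameter of the previous iteration, `τinit` at iteration `0`. -/
def τprev (τinit : ℝ) : ℕ → ℝ
  | 0 => τinit
  | k + 1 => R.τ k

/-- The model reduction at iteration `k`. -/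
def Δl (k : ℕ) : ℝ := P.modelReduction (R.x k) (R.τ k) (R.g P k) (R.d k)

/-- The (relaxed) classical sufficient decrease condition for the step size `α`. -/
def ClassicalCond (p : Params) (K : Constants) (k : ℕ) (α : ℝ) : Prop :=
  P.merit (R.Sf k) (R.x k + α • R.d k) (R.τ k)
    ≤ P.merit (R.Sf k) (R.x k) (R.τ k) - p.η * α * R.Δl P k
      + K.εA (R.τ k) (R.Sf k) (R.Sg k)

/-- The (relaxed) modified sufficient decrease condition for the step size `α`. -/
def ModifiedCond (p : Params) (K : Constants) (k : ℕ) (α : ℝ) : Prop :=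
  P.merit (R.Sf k) (R.x k + α • R.d k) (R.τ k)
    ≤ P.merit (R.Sf k) (R.x k) (R.τ k) - p.η * α * R.Δl P k
      + (1 / 2) * α ^ 2 * R.τ k * inner ℝ (R.d k) (R.H P k (R.d k))
      + (1 / 2) * α ^ 2 * ∑ i, |inner ℝ (R.d k) (P.hessC i (R.x k) (R.d k))|
      + K.εA (R.τ k) (R.Sf k) (R.Sg k)

end Run

/-- The run `R` is generated by the modified line search SQP algorithm; the starting point
`(R.x 0, R.y 0)` and the (nonempty) samples are arbitrary. -/
structure IsGenerated {n m N : ℕ} (P : Problem n m N) (p : Params) (K : Constants)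
    (R : Run n m N) : Prop where
  Sf_nonempty : ∀ k, (R.Sf k).Nonempty
  Sg_nonempty : ∀ k, (R.Sg k).Nonempty
  SH_nonempty : ∀ k, (R.SH k).Nonempty
  direction : ∀ k, R.M P k (pd (R.d k) (R.δ k)) = -P.residual (R.g P k) (R.x k) (R.y k)
  tau : ∀ k, R.τ k = tauUpdate p.ετ (R.τprev p.τinit k)
    (tauTrial p.σ (inner ℝ (R.g P k) (R.d k)) (inner ℝ (R.d k) (R.W P k (R.d k)))
      (l1Norm (P.c (R.x k))))
  gamma_zero : R.γ 0 = p.γinit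
  long_step : ∀ k, R.γ k < ‖R.d k‖ →
    IsBacktrack p.να (R.ClassicalCond P p K k) (R.α k) ∧ R.γ (k + 1) = R.γ k
  short_step_classical : ∀ k, ‖R.d k‖ ≤ R.γ k → R.ClassicalCond P p K k 1 →
    R.α k = 1 ∧ R.γ (k + 1) = R.γ k
  short_step_modified : ∀ k, ‖R.d k‖ ≤ R.γ k → ¬ R.ClassicalCond P p K k 1 →
    IsBacktrack p.να (R.ModifiedCond P p K k) (R.α k) ∧ R.γ (k + 1) = p.νγ * R.γ k
  x_succ : ∀ k, R.x (k + 1) = R.x k + R.α k • R.d k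
  y_succ : ∀ k, R.y (k + 1) = R.y k + R.δ k

/-- Smoothness, boundedness and regularity of `f` and `c` over a set `X` that contains the
iterates and the first trial points. -/
structure FunctionAssumption {n m N : ℕ} (P : Problem n m N) (K : Constants) (R : Run n m N)
    (X : Set (Vec n)) : Prop where
  m_le_n : m ≤ n
  isOpen : IsOpen X
  convex : Convex ℝ X
  iterate_mem : ∀ k, R.x k ∈ X
  trial_mem : ∀ k, R.x k + R.d k ∈ X
  f_bdd : ∀ x ∈ X, |P.f x| ≤ K.κf
  grad_bdd : ∀ x ∈ X, ‖gradient P.f x‖ ≤ K.κg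
  hess_bdd : ∀ x ∈ X, ‖hess P.f x‖ ≤ K.κH
  grad_lip : ∃ L₁ : ℝ, ∀ x ∈ X, ∀ z ∈ X, ‖gradient P.f x - gradient P.f z‖ ≤ L₁ * ‖x - z‖
  hess_lip : ∃ L₂ : ℝ, ∀ x ∈ X, ∀ z ∈ X, ‖hess P.f x - hess P.f z‖ ≤ L₂ * ‖x - z‖
  c_bdd : ∀ x ∈ X, ‖P.c x‖ ≤ K.κc
  J_bdd : ∃ B : ℝ, ∀ x ∈ X, ‖P.J x‖ ≤ B
  J_lip : ∃ Γ₁ : ℝ, ∀ x ∈ X, ∀ z ∈ X, ‖P.J x - P.J z‖ ≤ Γ₁ * ‖x - z‖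
  hessC_lip : ∃ Γ₂ : ℝ, ∀ i, ∀ x ∈ X, ∀ z ∈ X, ‖P.hessC i x - P.hessC i z‖ ≤ Γ₂ * ‖x - z‖
  /-- the singular values of `J(x)` are bounded away from zero over `X` -/
  J_singular : ∃ s > 0, ∀ x ∈ X, ∀ v, s * ‖v‖ ≤ ‖P.Jt x v‖
  J_pinv : ∀ k, ‖(P.J (R.x k) ∘L P.Jt (R.x k)).inverse ∘L P.J (R.x k)‖ ≤ K.κJ

/-- `(xs, ys)` is a first-order stationary point near which the gradient and the Hessian of the
Lagrangian are Lipschitz continuous. -/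
structure LagrangianAssumption {n m N : ℕ} (P : Problem n m N) (K : Constants)
    (xs : Vec n) (ys : Vec m) : Prop where
  stationary : P.IsStationary xs ys
  LgradL_pos : 0 < K.LgradL
  LW_pos : 0 < K.LW
  lip : ∃ r > 0, ∀ w ∈ Metric.ball (pd xs ys) r, ∀ w' ∈ Metric.ball (pd xs ys) r,
    ‖gradient P.lagrangian w - gradient P.lagrangian w'‖ ≤ K.LgradL * ‖w - w'‖ ∧
    ‖hess P.lagrangian w - hess P.lagrangian w'‖ ≤ K.LW * ‖w - w'‖

/-- The components `fᵢ` and their derivatives are bounded in terms of `f` over `X`. -/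
structure ComponentAssumption {n m N : ℕ} (P : Problem n m N) (K : Constants)
    (X : Set (Vec n)) : Prop where
  κ₀_pos : 0 < K.κ₀
  μ₀_pos : 0 < K.μ₀
  κ₁_pos : 0 < K.κ₁
  μ₁_pos : 0 < K.μ₁
  κ₂_pos : 0 < K.κ₂
  μ₂_pos : 0 < K.μ₂
  comp_bdd : ∀ x ∈ X, ∀ i, |P.comp i x| ≤ K.κ₀ + K.μ₀ * |P.f x|
  grad_bdd : ∀ x ∈ X, ∀ i, ‖gradient (P.comp i) x‖ ≤ K.κ₁ + K.μ₁ * ‖gradient P.f x‖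
  hess_bdd : ∀ x ∈ X, ∀ i, ‖hess (P.comp i) x‖ ≤ K.κ₂ + K.μ₂ * ‖hess P.f x‖

/-- Bounds on the matrices of the subsampled linear systems along the run. -/
structure MatrixAssumption {n m N : ℕ} (P : Problem n m N) (K : Constants)
    (R : Run n m N) : Prop where
  κW_pos : 0 < K.κW
  ζ_pos : 0 < K.ζ
  Λ_pos : 0 < K.Λ
  κM_pos : 0 < K.κM
  W_bdd : ∀ k, ‖R.W P k‖ ≤ K.κW
  W_curv : ∀ k u, P.J (R.x k) u = 0 → K.ζ * ‖u‖ ^ 2 ≤ inner ℝ u (R.W P k u)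
  M_inv : ∀ k, (R.M P k).IsInvertible
  M_inv_bdd : ∀ k, ‖(R.M P k).inverse‖ ≤ K.Λ
  M_bdd : ∀ k, ‖R.M P k‖ ≤ K.κM

/-- Whenever the exact search direction `d` at the iterate `w_k` has norm at most `κd`, the
distance to the stationary point is bounded by the gradient of the Lagrangian. -/
structure ErrorBoundAssumption {n m N : ℕ} (P : Problem n m N) (K : Constants) (R : Run n m N)
    (xs : Vec n) (ys : Vec m) : Prop where
  κd_pos : 0 < K.κd
  μM_pos : 0 < K.μM
  bound : ∀ k d δ,
    P.kkt (P.lagHess (hess P.f (R.x k)) (R.x k) (R.y k)) (R.x k) (pd d δ)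
      = -P.residual (gradient P.f (R.x k)) (R.x k) (R.y k) →
    ‖d‖ ≤ K.κd →
    K.μM / 2 * ‖R.w k - pd xs ys‖ ≤ ‖P.residual (gradient P.f (R.x k)) (R.x k) (R.y k)‖

/-- `κl` is a positive constant with `Δl_k ≥ κl τ_k ‖d_k‖²` along the run. -/
def IsModelReductionConstant {n m N : ℕ} (P : Problem n m N) (R : Run n m N) (κl : ℝ) : Prop :=
  0 < κl ∧ ∀ k, κl * R.τ k * ‖R.d k‖ ^ 2 ≤ R.Δl P k

/-- `u_k → l` at an R-superlinear rate. -/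
def ConvergesRSuperlinearly {E : Type*} [NormedAddCommGroup E] (u : ℕ → E) (l : E) : Prop :=
  Tendsto u atTop (𝓝 l) ∧ ∃ ξ : ℕ → ℝ, (∀ k, 0 < ξ k) ∧ (∀ k, ‖u k - l‖ ≤ ξ k) ∧
    Tendsto (fun k => ξ (k + 1) / ξ k) atTop (𝓝 0)

end ModifiedSQP

end

/-! The sample space is finite, so a nonzero sampling deficit is at least `1 / N`. Summability, and
convergence of the Hessian sample sizes to `N`, therefore force full samples from some iteration on.
From there the run is a deterministic SQP method without relaxation, and what remains is a global
convergence argument followed by a local Newton argument.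

Globally, the multipliers after full iterations are bounded because `(d, y_{k+1})` solves a
uniformly invertible linear system. Hence the merit parameter is bounded below and eventually
constant (`exists_tau_eq`). Steps accepted by the modified condition may increase the merit
function, but by at most a multiple of `γ_k ^ 2`, and exactly these steps shrink `γ`. Adding a
suitable multiple of `γ_k ^ 2` to the merit function gives a decreasing potential, whence `d_k → 0`
(`tendsto_d`). The KKT residual is controlled by two successive directions, so the error bound
yields `w_k → w*` (`tendsto_w`).

Locally, a full step has error `o(‖x_k - x*‖)` (`eventually_norm_step_le`). The modified condition
contains the second-order terms of the merit function, so it accepts the unit step once `d_k` is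
small. Fast contraction of the directions keeps them below `γ_k`, where unit steps are taken
(`eventually_alpha_eq_one`), and the Newton estimate becomes the rate of the iterates. -/

namespace ModifiedSQP

/-! ### Taylor estimates on a convex set. -/

section Calculus

variable {E : Type*} [NormedAddCommGroup E] [InnerProductSpace ℝ E]

theorem norm_taylor_one_le {F : Type*} [NormedAddCommGroup F] [NormedSpace ℝ F]
    {f : E → F} (hf : Differentiable ℝ f) {X : Set E} (hX : Convex ℝ X)
    {L : ℝ} (hL : 0 ≤ L) (hlip : ∀ x ∈ X, ∀ z ∈ X, ‖fderiv ℝ f x - fderiv ℝ f z‖ ≤ L * ‖x - z‖)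
    {x d : E} (hx : x ∈ X) (hd : x + d ∈ X) :
    ‖f (x + d) - f x - fderiv ℝ f x d‖ ≤ L * ‖d‖ ^ 2 := by
  have h := Convex.norm_image_sub_le_of_norm_fderiv_le' (𝕜 := ℝ) (f := f)
    (s := segment ℝ x (x + d)) (φ := fderiv ℝ f x) (C := L * ‖d‖) (x := x) (y := x + d)
    (fun z _ => hf z) ?_ (convex_segment _ _) (left_mem_segment _ _ _) (right_mem_segment _ _ _)
  · simpa [pow_two, mul_assoc] using h
  · intro z hz
    refine (hlip z (hX.segment_subset hx hd hz) x hx).trans ?_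
    gcongr
    simpa using norm_sub_le_of_mem_segment hz

variable [CompleteSpace E]

theorem norm_gradient_sub (f : E → ℝ) (x z : E) :
    ‖gradient f x - gradient f z‖ = ‖fderiv ℝ f x - fderiv ℝ f z‖ := by
  simp only [gradient, ← map_sub, LinearIsometryEquiv.norm_map]

theorem contDiff_gradient {f : E → ℝ} (hf : ContDiff ℝ 2 f) : ContDiff ℝ 1 (gradient f) :=
  (InnerProductSpace.toDual ℝ E).symm.contDiff.comp (hf.fderiv_right (by norm_num))

theorem hasFDerivAt_gradient {f : E → ℝ} (hf : ContDiff ℝ 2 f) (x : E) :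
    HasFDerivAt (gradient f) (hess f x) x :=
  ((contDiff_gradient hf).differentiable (by norm_num) x).hasFDerivAt

theorem continuous_hess {f : E → ℝ} (hf : ContDiff ℝ 2 f) : Continuous (hess f) :=
  (contDiff_gradient hf).continuous_fderiv (by norm_num)

/-- Along the segment, the remainder has derivative `⟨d, first-order remainder of the gradient⟩`,
which is at most `L * ‖d‖ ^ 3`; the mean value inequality on `[0, 1]` concludes. The sharp factor `1
/ 6` is not needed. -/
theorem abs_taylor_two_le {f : E → ℝ} (hf : ContDiff ℝ 2 f) {X : Set E} (hX : Convex ℝ X)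
    {L : ℝ} (hL : 0 ≤ L) (hlip : ∀ x ∈ X, ∀ z ∈ X, ‖hess f x - hess f z‖ ≤ L * ‖x - z‖)
    {x d : E} (hx : x ∈ X) (hd : x + d ∈ X) :
    |f (x + d) - f x - inner ℝ (gradient f x) d - 1 / 2 * inner ℝ d (hess f x d)|
      ≤ L * ‖d‖ ^ 3 := by
  set φ : ℝ → ℝ := fun t => f (x + t • d) - t * inner ℝ (gradient f x) d
    - t ^ 2 / 2 * inner ℝ d (hess f x d)
  have hder : ∀ t : ℝ, HasDerivAt φ (inner ℝ d (gradient f (x + t • d) - gradient f x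
      - hess f x (t • d))) t := by
    intro t
    have h1 : HasDerivAt (fun t : ℝ => x + t • d) d t := by
      simpa using ((hasDerivAt_id t).smul_const d).const_add x
    have h2 := ((hf.differentiable (by norm_num)) (x + t • d)).hasFDerivAt.comp_hasDerivAt t h1
    have h3 := (h2.sub ((hasDerivAt_id t).mul_const (inner ℝ (gradient f x) d))).sub
      ((((hasDerivAt_id t).pow 2).div_const 2).mul_const (inner ℝ d (hess f x d)))
    refine h3.congr_deriv ?_
    rw [inner_sub_right, inner_sub_right, map_smul, inner_smul_right, ← inner_gradient_left,
      real_inner_comm d (gradient f x), real_inner_comm d (gradient f (x + t • d))]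
    simp
  have hb : ∀ t ∈ Set.Ico (0 : ℝ) 1, ‖inner ℝ d (gradient f (x + t • d) - gradient f x
      - hess f x (t • d))‖ ≤ L * ‖d‖ ^ 3 := by
    intro t ht
    have hmem : x + t • d ∈ X := by
      have := hX.segment_subset hx hd
      refine this ⟨1 - t, t, by linarith [ht.2], ht.1, by ring, ?_⟩
      module
    have h := norm_taylor_one_le ((contDiff_gradient hf).differentiable (by norm_num)) hX hL hlip
      hx hmem
    refine (norm_inner_le_norm _ _).trans ?_
    have hn : ‖t • d‖ ≤ ‖d‖ := by
      rw [norm_smul, Real.norm_eq_abs, abs_of_nonneg ht.1]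
      exact mul_le_of_le_one_left (norm_nonneg _) ht.2.le
    calc ‖d‖ * ‖gradient f (x + t • d) - gradient f x - hess f x (t • d)‖
        ≤ ‖d‖ * (L * ‖d‖ ^ 2) := by
          gcongr
          exact h.trans (by gcongr)
      _ = L * ‖d‖ ^ 3 := by ring
  have := norm_image_sub_le_of_norm_deriv_le_segment_01' (fun t _ => (hder t).hasDerivWithinAt) hb
  simp only [φ, Real.norm_eq_abs] at this
  convert this using 2
  simp
  ring

theorem norm_hess_le_of_lipschitz {f : E → ℝ} (hf : ContDiff ℝ 2 f) {X : Set E} (hX : IsOpen X)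
    {L : ℝ} (hL : 0 ≤ L) (hlip : ∀ x ∈ X, ∀ z ∈ X, ‖gradient f x - gradient f z‖ ≤ L * ‖x - z‖)
    {x : E} (hx : x ∈ X) : ‖hess f x‖ ≤ L :=
  (hasFDerivAt_gradient hf x).le_of_lip' hL
    (by filter_upwards [hX.mem_nhds hx] with z hz using hlip z hz x hx)

end Calculus

section L1Norm

variable {m : ℕ}

theorem l1Norm_nonneg (v : Vec m) : 0 ≤ l1Norm v := Finset.sum_nonneg fun _ _ => abs_nonneg _

theorem l1Norm_add_le (u v : Vec m) : l1Norm (u + v) ≤ l1Norm u + l1Norm v := by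
  simp only [l1Norm, ← Finset.sum_add_distrib]
  exact Finset.sum_le_sum fun i _ => abs_add_le _ _

theorem l1Norm_smul (a : ℝ) (v : Vec m) : l1Norm (a • v) = |a| * l1Norm v := by
  simp [l1Norm, abs_mul, Finset.mul_sum]

theorem norm_le_l1Norm (v : Vec m) : ‖v‖ ≤ l1Norm v := by
  refine le_of_sq_le_sq ?_ (l1Norm_nonneg v)
  rw [EuclideanSpace.norm_sq_eq]
  exact Finset.sum_sq_le_sq_sum_of_nonneg fun _ _ => abs_nonneg _

theorem l1Norm_le (v : Vec m) : l1Norm v ≤ m * ‖v‖ := by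
  have : l1Norm v ≤ ∑ _i : Fin m, ‖v‖ := Finset.sum_le_sum fun i _ => PiLp.norm_apply_le v i
  simpa using this

end L1Norm

section PrimalDual

variable {n m N : ℕ}

theorem pd_sub (u u' : Vec n) (v v' : Vec m) : pd u v - pd u' v' = pd (u - u') (v - v') := rfl

theorem pd_neg (u : Vec n) (v : Vec m) : -pd u v = pd (-u) (-v) := rfl

theorem pd_inj {u u' : Vec n} {v v' : Vec m} : pd u v = pd u' v' ↔ u = u' ∧ v = v' :=
  ⟨fun h => ⟨congrArg WithLp.fst h, congrArg WithLp.snd h⟩, fun ⟨h, h'⟩ => by rw [h, h']⟩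

theorem norm_pd_sq (u : Vec n) (v : Vec m) : ‖pd u v‖ ^ 2 = ‖u‖ ^ 2 + ‖v‖ ^ 2 :=
  WithLp.prod_norm_sq_eq_of_L2 _

theorem norm_le_norm_pd_left (u : Vec n) (v : Vec m) : ‖u‖ ≤ ‖pd u v‖ :=
  le_of_sq_le_sq (by rw [norm_pd_sq]; nlinarith [norm_nonneg v]) (norm_nonneg _)

theorem norm_le_norm_pd_right (u : Vec n) (v : Vec m) : ‖v‖ ≤ ‖pd u v‖ :=
  le_of_sq_le_sq (by rw [norm_pd_sq]; nlinarith [norm_nonneg u]) (norm_nonneg _)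

theorem norm_pd_le (u : Vec n) (v : Vec m) : ‖pd u v‖ ≤ ‖u‖ + ‖v‖ :=
  le_of_sq_le_sq (by rw [norm_pd_sq]; nlinarith [norm_nonneg u, norm_nonneg v]) (by positivity)

theorem Problem.kkt_pd (P : Problem n m N) (W : Vec n →L[ℝ] Vec n) (x u : Vec n) (v : Vec m) :
    P.kkt W x (pd u v) = pd (W u + P.Jt x v) (P.J x u) := rfl

end PrimalDual

/-! ### Derivatives of the objective, the constraints and the Lagrangian. -/

namespace Problem

variable {n m N : ℕ} (P : Problem n m N)

theorem contDiff_c_apply (i : Fin m) : ContDiff ℝ 2 (fun z => P.c z i) :=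
  (EuclideanSpace.proj (𝕜 := ℝ) i).contDiff.comp P.c_contDiff

theorem differentiable_c : Differentiable ℝ P.c := P.c_contDiff.differentiable (by norm_num)

theorem contDiff_f : ContDiff ℝ 2 P.f :=
  contDiff_const.mul (ContDiff.sum fun i _ => P.comp_contDiff i)

theorem fderiv_c_apply (i : Fin m) (x : Vec n) :
    fderiv ℝ (fun z => P.c z i) x = (EuclideanSpace.proj (𝕜 := ℝ) i) ∘L P.J x :=
  ((EuclideanSpace.proj (𝕜 := ℝ) i).hasFDerivAt.comp x (P.differentiable_c x).hasFDerivAt).fderiv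

theorem inner_gradient_c (i : Fin m) (x d : Vec n) :
    inner ℝ (gradient (fun z => P.c z i) x) d = P.J x d i := by
  rw [inner_gradient_left, fderiv_c_apply]; rfl

theorem Jt_apply (x : Vec n) (y : Vec m) :
    P.Jt x y = ∑ i, y i • gradient (fun z => P.c z i) x := by
  refine ext_inner_right ℝ fun d => ?_
  rw [Jt, ContinuousLinearMap.adjoint_inner_left, sum_inner]
  simp_rw [inner_smul_left, inner_gradient_c]
  rw [PiLp.inner_apply]
  simp [mul_comm]

theorem inner_Jt (x u : Vec n) (y : Vec m) : inner ℝ u (P.Jt x y) = inner ℝ (P.J x u) y :=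
  ContinuousLinearMap.adjoint_inner_right _ _ _

theorem norm_gradient_c_sub_le (i : Fin m) (x z : Vec n) :
    ‖gradient (fun z => P.c z i) x - gradient (fun z => P.c z i) z‖ ≤ ‖P.J x - P.J z‖ := by
  rw [norm_gradient_sub, fderiv_c_apply, fderiv_c_apply, ← ContinuousLinearMap.comp_sub]
  refine ContinuousLinearMap.opNorm_le_bound _ (norm_nonneg _) fun v => ?_
  exact (PiLp.norm_apply_le ((P.J x - P.J z) v) i).trans ((P.J x - P.J z).le_opNorm v)

theorem norm_Jt_sub_apply_le (x z : Vec n) (y : Vec m) :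
    ‖P.Jt x y - P.Jt z y‖ ≤ ‖P.J x - P.J z‖ * ‖y‖ := by
  have h : P.Jt x y - P.Jt z y = ContinuousLinearMap.adjoint (P.J x - P.J z) y := by
    simp [Jt, map_sub]
  rw [h]
  refine (ContinuousLinearMap.le_opNorm _ _).trans (le_of_eq ?_)
  rw [LinearIsometryEquiv.norm_map]

theorem continuous_J : Continuous P.J := P.c_contDiff.continuous_fderiv (by norm_num)

theorem tendsto_lagHess {x : ℕ → Vec n} {y : ℕ → Vec m} {xs : Vec n} {ys : Vec m}
    (hx : Tendsto x atTop (𝓝 xs)) (hy : Tendsto y atTop (𝓝 ys)) :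
    Tendsto (fun k => P.lagHess (hess P.f (x k)) (x k) (y k)) atTop
      (𝓝 (P.lagHess (hess P.f xs) xs ys)) := by
  refine (((continuous_hess P.contDiff_f).tendsto xs).comp hx).add
    (tendsto_finsetSum _ fun i _ => Tendsto.smul ?_
      (((continuous_hess (P.contDiff_c_apply i)).tendsto xs).comp hx))
  exact ((EuclideanSpace.proj (𝕜 := ℝ) i).continuous.tendsto ys).comp hy

/-- With the multiplier frozen, the Lagrangian gradient is differentiable in `x`; at the solution
this supplies the `o(‖x - xs‖)` linearization of the Newton estimate. -/
theorem hasFDerivAt_gradient_add_Jt (x : Vec n) (y : Vec m) :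
    HasFDerivAt (fun z => gradient P.f z + P.Jt z y) (P.lagHess (hess P.f x) x y) x := by
  simp only [Jt_apply]
  exact (hasFDerivAt_gradient P.contDiff_f x).add (HasFDerivAt.fun_sum fun i _ =>
    (hasFDerivAt_gradient (P.contDiff_c_apply i) x).const_smul (y i))

theorem gradient_lagrangian_left (x : Vec n) (y : Vec m) :
    gradient (fun z => P.lagrangian (pd z y)) x = gradient P.f x + P.Jt x y := by
  have h1 := (P.contDiff_f.differentiable (by norm_num) x).hasFDerivAt
  have h2 := (innerSL ℝ y).hasFDerivAt.comp x (P.differentiable_c x).hasFDerivAt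
  refine ext_inner_right ℝ fun d => ?_
  rw [inner_gradient_left, inner_add_left, inner_gradient_left, Jt,
    ContinuousLinearMap.adjoint_inner_left]
  have h3 : HasFDerivAt (fun z => P.lagrangian (pd z y)) _ x := h1.add h2
  rw [h3.fderiv]
  rfl

theorem fS_univ : P.fS Finset.univ = P.f := by
  funext x; simp [fS, f]

theorem gS_univ (x : Vec n) : P.gS Finset.univ x = gradient P.f x := by
  have h : HasFDerivAt P.f ((1 / (N : ℝ)) • ∑ i, fderiv ℝ (P.comp i) x) x :=
    (HasFDerivAt.fun_sum fun i _ =>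
      ((P.comp_contDiff i).differentiable (by norm_num) x).hasFDerivAt).const_mul _
  rw [gradient, h.fderiv]
  simp [gS, gradient]

theorem HS_univ (x : Vec n) : P.HS Finset.univ x = hess P.f x := by
  have h : gradient P.f = fun x => (1 / (N : ℝ)) • ∑ i, gradient (P.comp i) x := by
    funext z; rw [← gS_univ]; simp [gS]
  have h' : HasFDerivAt (gradient P.f) ((1 / (N : ℝ)) • ∑ i, hess (P.comp i) x) x := by
    rw [h]
    exact (HasFDerivAt.fun_sum fun i _ =>
      hasFDerivAt_gradient (P.comp_contDiff i) x).const_smul (1 / (N : ℝ))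
  rw [hess, h'.fderiv]
  simp [HS]

end Problem

end ModifiedSQP

namespace ModifiedSQP

/-! ### The merit parameter and the model reduction. -/

section MeritParameter

variable {σ ετ τ gd curv c1 : ℝ}

/-- The properties of one update of the merit parameter. -/
theorem tauUpdate_spec (hσ : σ ∈ Set.Ioo (0 : ℝ) 1) (hε : ετ ∈ Set.Ioo (0 : ℝ) 1) (hτ : 0 < τ)
    (hc : 0 ≤ c1) (h0 : c1 = 0 → gd + max curv 0 ≤ 0) :
    let τ' := tauUpdate ετ τ (tauTrial σ gd curv c1)
    0 < τ' ∧ τ' * (gd + max curv 0) ≤ (1 - σ) * c1 ∧ (τ' = τ ∨ τ' ≤ (1 - ετ) * τ) ∧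
      ∀ C > 0, gd + max curv 0 ≤ C * c1 → min τ ((1 - ετ) * ((1 - σ) / C)) ≤ τ' := by
  obtain ⟨hσ0, hσ1⟩ := hσ
  obtain ⟨hε0, hε1⟩ := hε
  intro τ'
  rcases le_or_gt (gd + max curv 0) 0 with hq | hq
  · have h : τ' = τ := by simp [τ', tauTrial, tauUpdate, hq]
    rw [h]
    refine ⟨hτ, ?_, .inl rfl, fun C _ _ => min_le_left _ _⟩
    exact (mul_nonpos_of_nonneg_of_nonpos hτ.le hq).trans (mul_nonneg (by linarith) hc)
  · have hc' : 0 < c1 := lt_of_le_of_ne hc fun h => absurd (h0 h.symm) (not_le.2 hq)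
    set t := (1 - σ) * c1 / (gd + max curv 0) with ht
    have htq : t * (gd + max curv 0) = (1 - σ) * c1 := div_mul_cancel₀ _ hq.ne'
    have htpos : 0 < t := div_pos (mul_pos (by linarith) hc') hq
    have htrial : tauTrial σ gd curv c1 = (t : EReal) := by simp [tauTrial, not_le.2 hq, ht]
    by_cases hle : τ ≤ t
    · have h : τ' = τ := by simp [τ', htrial, tauUpdate, hle]
      rw [h]
      refine ⟨hτ, ?_, .inl rfl, fun C _ _ => min_le_left _ _⟩
      rw [← htq]
      gcongr
    · have h : τ' = (1 - ετ) * t := by simp [τ', htrial, tauUpdate, hle]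
      rw [h]
      push Not at hle
      refine ⟨mul_pos (by linarith) htpos, ?_, .inr ?_, fun C hC hqC => ?_⟩
      · rw [mul_assoc, htq]
        exact mul_le_of_le_one_left (mul_nonneg (by linarith) hc) (by linarith)
      · exact mul_le_mul_of_nonneg_left hle.le (by linarith)
      · refine (min_le_right _ _).trans (mul_le_mul_of_nonneg_left ?_ (by linarith))
        rw [ht, div_le_div_iff₀ hC hq]
        nlinarith

/-- A positive sequence that either stays or shrinks by a fixed factor, and is bounded away from
zero, is eventually constant. -/
theorem eventually_const_of_shrink {u : ℕ → ℝ} {r b : ℝ} (hr : r < 1) (hb : 0 < b)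
    (hu : ∀ k, b ≤ u k) (hstep : ∀ k, u (k + 1) = u k ∨ u (k + 1) ≤ r * u k) :
    ∃ k₀, ∀ k ≥ k₀, u k = u k₀ := by
  have hanti : Antitone u := antitone_nat_of_succ_le fun k => by
    rcases hstep k with h | h
    · exact h.le
    · exact h.trans (mul_le_of_le_one_left (hb.le.trans (hu k)) hr.le)
  have hbdd : BddBelow (Set.range u) := ⟨b, by rintro _ ⟨k, rfl⟩; exact hu k⟩
  have hinf : b ≤ ⨅ k, u k := le_ciInf hu
  -- Once `r * u k` is below the infimum, another shrinking step would pass below it.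
  have hlt : r * (⨅ k, u k) < ⨅ k, u k := by nlinarith
  have hlim := (tendsto_atTop_ciInf hanti hbdd).const_mul r
  obtain ⟨k₀, hk₀⟩ := eventually_atTop.1 (hlim.eventually_lt_const hlt)
  refine ⟨k₀, fun k hk => ?_⟩
  induction k, hk using Nat.le_induction with
  | base => rfl
  | succ k hk ih =>
    rcases hstep k with h | h
    · rw [h, ih]
    · exact absurd (h.trans_lt (hk₀ k hk)) (not_lt.2 (ciInf_le hbdd _))

end MeritParameter

variable {n m N : ℕ} {P : Problem n m N} {p : Params} {K : Constants} {R : Run n m N}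
  {X : Set (Vec n)}

namespace MatrixAssumption

theorem norm_le (hmat : MatrixAssumption P K R) (k : ℕ) (z : PrimalDual n m) :
    ‖z‖ ≤ K.Λ * ‖R.M P k z‖ := by
  have h : (R.M P k).inverse (R.M P k z) = z := (hmat.M_inv k).inverse_apply_eq.2 rfl
  calc ‖z‖ = ‖(R.M P k).inverse (R.M P k z)‖ := by rw [h]
    _ ≤ ‖(R.M P k).inverse‖ * ‖R.M P k z‖ := ContinuousLinearMap.le_opNorm _ _
    _ ≤ _ := by gcongr; exact hmat.M_inv_bdd k

/-- Solving the KKT system with right-hand side `(0, b)` gives a right inverse of the Jacobian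
bounded by `Λ`. -/
theorem exists_J_eq (hmat : MatrixAssumption P K R) (k : ℕ) (b : Vec m) :
    ∃ v, P.J (R.x k) v = b ∧ ‖v‖ ≤ K.Λ * ‖b‖ := by
  obtain ⟨z, hz⟩ : ∃ z, R.M P k z = pd 0 b :=
    ⟨(R.M P k).inverse (pd 0 b), ((hmat.M_inv k).inverse_apply_eq.1 rfl).symm⟩
  refine ⟨z.fst, congrArg WithLp.snd hz, ?_⟩
  have h := hmat.norm_le k z
  rw [hz] at h
  have hb : ‖pd (0 : Vec n) b‖ ≤ ‖b‖ := by simpa using norm_pd_le (0 : Vec n) b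
  exact (norm_le_norm_pd_left z.fst z.snd).trans
    (h.trans (mul_le_mul_of_nonneg_left hb hmat.Λ_pos.le))

/-- The curvature of the search direction up to a multiple of the infeasibility. -/
theorem curvature_le (hmat : MatrixAssumption P K R) (k : ℕ) (d : Vec n) :
    K.ζ / 4 * ‖d‖ ^ 2 - (K.ζ / 2 + 2 * K.κW ^ 2 / K.ζ + K.κW) * (K.Λ * ‖P.J (R.x k) d‖) ^ 2
      ≤ inner ℝ d (R.W P k d) := by
  obtain ⟨v, hv, hvn⟩ := hmat.exists_J_eq k (P.J (R.x k) d)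
  -- Split `d` into a null-space part `u`, where the curvature bound applies, and a part `v` of the
  -- size of `J d`; Young's inequality absorbs the cross terms.
  set u := d - v with hu
  have hd : d = u + v := by simp [hu]
  have hζ := hmat.ζ_pos
  have hcurv := hmat.W_curv k u (by rw [hu, map_sub, hv, sub_self])
  have hW : ∀ a b : Vec n, |inner ℝ a (R.W P k b)| ≤ K.κW * ‖a‖ * ‖b‖ := fun a b =>
    calc |inner ℝ a (R.W P k b)| ≤ ‖a‖ * ‖R.W P k b‖ := abs_real_inner_le_norm _ _
      _ ≤ ‖a‖ * (K.κW * ‖b‖) := by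
        gcongr
        exact (R.W P k).le_of_opNorm_le (hmat.W_bdd k) b
      _ = _ := by ring
  have h1 := neg_le_of_abs_le (hW u v)
  have h2 := neg_le_of_abs_le (hW v u)
  have h3 := neg_le_of_abs_le (hW v v)
  have hexp : inner ℝ d (R.W P k d) = inner ℝ u (R.W P k u) + inner ℝ u (R.W P k v)
      + inner ℝ v (R.W P k u) + inner ℝ v (R.W P k v) := by
    rw [hd, map_add, inner_add_left, inner_add_right, inner_add_right]; ring
  have hyoung : 2 * (K.κW * ‖u‖ * ‖v‖) ≤ K.ζ / 2 * ‖u‖ ^ 2 + 2 * K.κW ^ 2 / K.ζ * ‖v‖ ^ 2 := by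
    have : K.ζ / 2 * ‖u‖ ^ 2 + 2 * K.κW ^ 2 / K.ζ * ‖v‖ ^ 2 - 2 * (K.κW * ‖u‖ * ‖v‖)
        = (K.ζ * ‖u‖ - 2 * K.κW * ‖v‖) ^ 2 / (2 * K.ζ) := by field_simp; ring
    have : 0 ≤ (K.ζ * ‖u‖ - 2 * K.κW * ‖v‖) ^ 2 / (2 * K.ζ) := by positivity
    linarith
  have hdn : ‖d‖ ^ 2 ≤ 2 * ‖u‖ ^ 2 + 2 * ‖v‖ ^ 2 := by
    have : ‖d‖ ≤ ‖u‖ + ‖v‖ := by rw [hd]; exact norm_add_le _ _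
    nlinarith [norm_nonneg d, sq_nonneg (‖u‖ - ‖v‖)]
  have hvsq : ‖v‖ ^ 2 ≤ (K.Λ * ‖P.J (R.x k) d‖) ^ 2 := by gcongr
  have hC : 0 ≤ K.ζ / 2 + 2 * K.κW ^ 2 / K.ζ + K.κW := by have := hmat.κW_pos; positivity
  have := mul_le_mul_of_nonneg_left hvsq hC
  rw [hexp]
  nlinarith

end MatrixAssumption

namespace IsGenerated

theorem W_apply_d (hR : IsGenerated P p K R) (k : ℕ) :
    R.W P k (R.d k) + P.Jt (R.x k) (R.y (k + 1)) = -R.g P k := by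
  have h := hR.direction k
  rw [Run.M, Problem.kkt_pd, Problem.residual, pd_neg, pd_inj] at h
  rw [hR.y_succ, map_add, add_comm (P.Jt (R.x k) (R.y k)), ← add_assoc, h.1]
  abel

theorem J_apply_d (hR : IsGenerated P p K R) (k : ℕ) : P.J (R.x k) (R.d k) = -P.c (R.x k) := by
  have h := hR.direction k
  rw [Run.M, Problem.kkt_pd, Problem.residual, pd_neg, pd_inj] at h
  exact h.2

theorem M_apply (hR : IsGenerated P p K R) (k : ℕ) :
    R.M P k (pd (R.d k) (R.y (k + 1))) = -pd (R.g P k) (P.c (R.x k)) := by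
  rw [Run.M, Problem.kkt_pd, hR.W_apply_d, hR.J_apply_d, pd_neg]

/-- This is the first block row of the linear system paired with `d`, with `J d = -c` from the
second row. -/
theorem inner_g_add_curvature (hR : IsGenerated P p K R) (k : ℕ) :
    inner ℝ (R.g P k) (R.d k) + inner ℝ (R.d k) (R.W P k (R.d k))
      = inner ℝ (P.c (R.x k)) (R.y (k + 1)) := by
  have h := congrArg (fun z => inner ℝ (R.d k) z) (hR.W_apply_d k)
  simp only [inner_add_right, P.inner_Jt, hR.J_apply_d, inner_neg_left, inner_neg_right] at h
  rw [real_inner_comm]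
  linarith

/-- The curvature along the search direction up to a multiple of the infeasibility. -/
theorem exists_curvature_le (hR : IsGenerated P p K R) (hfun : FunctionAssumption P K R X)
    (hmat : MatrixAssumption P K R) :
    ∃ C ≥ 0, ∀ k, K.ζ / 4 * ‖R.d k‖ ^ 2 - C * l1Norm (P.c (R.x k))
      ≤ inner ℝ (R.d k) (R.W P k (R.d k)) := by
  have hζ := hmat.ζ_pos
  have hκW := hmat.κW_pos
  have hκc : 0 ≤ K.κc := (norm_nonneg _).trans (hfun.c_bdd _ (hfun.iterate_mem 0))
  refine ⟨(K.ζ / 2 + 2 * K.κW ^ 2 / K.ζ + K.κW) * (K.Λ ^ 2 * K.κc), by positivity, fun k => ?_⟩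
  refine le_trans ?_ (hmat.curvature_le k (R.d k))
  rw [hR.J_apply_d, norm_neg, mul_assoc]
  gcongr
  have h1 := hfun.c_bdd _ (hfun.iterate_mem k)
  have h2 := norm_le_l1Norm (P.c (R.x k))
  -- One factor `‖c‖` is absorbed into `κc`, which turns the square into a bound linear in the `ℓ₁`
  -- norm.
  calc (K.Λ * ‖P.c (R.x k)‖) ^ 2 = K.Λ ^ 2 * (‖P.c (R.x k)‖ * ‖P.c (R.x k)‖) := by ring
    _ ≤ K.Λ ^ 2 * (K.κc * l1Norm (P.c (R.x k))) := by gcongr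
    _ = _ := by ring

/-- At a feasible point `d` lies in the null space of `J`, so its curvature is nonnegative and `gᵀd
+ dᵀWd = cᵀy_{k+1} = 0`. This makes the merit parameter update well posed. -/
theorem inner_g_add_max_nonpos (hR : IsGenerated P p K R) (hmat : MatrixAssumption P K R) (k : ℕ)
    (h : l1Norm (P.c (R.x k)) = 0) :
    inner ℝ (R.g P k) (R.d k) + max (inner ℝ (R.d k) (R.W P k (R.d k))) 0 ≤ 0 := by
  have hc : P.c (R.x k) = 0 := norm_le_zero_iff.1 (h ▸ norm_le_l1Norm _)
  have h1 := hR.inner_g_add_curvature k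
  have h2 := hmat.W_curv k (R.d k) (by rw [hR.J_apply_d, hc, neg_zero])
  rw [hc, inner_zero_left] at h1
  rw [max_eq_left ((mul_nonneg hmat.ζ_pos.le (sq_nonneg _)).trans h2), h1]

theorem tau_prev_pos (hR : IsGenerated P p K R) (hmat : MatrixAssumption P K R) (k : ℕ) :
    0 < R.τprev p.τinit k := by
  induction k with
  | zero => exact p.τinit_pos
  | succ k ih =>
    change 0 < R.τ k
    rw [hR.tau k]
    exact (tauUpdate_spec p.σ_mem p.ετ_mem ih (l1Norm_nonneg _) (hR.inner_g_add_max_nonpos hmat k)).1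

theorem tau_spec (hR : IsGenerated P p K R) (hmat : MatrixAssumption P K R) (k : ℕ) :
    0 < R.τ k ∧ R.τ k * (inner ℝ (R.g P k) (R.d k) + max (inner ℝ (R.d k) (R.W P k (R.d k))) 0)
        ≤ (1 - p.σ) * l1Norm (P.c (R.x k)) ∧
      (R.τ k = R.τprev p.τinit k ∨ R.τ k ≤ (1 - p.ετ) * R.τprev p.τinit k) ∧
      ∀ C > 0, inner ℝ (R.g P k) (R.d k) + max (inner ℝ (R.d k) (R.W P k (R.d k))) 0
          ≤ C * l1Norm (P.c (R.x k)) →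
        min (R.τprev p.τinit k) ((1 - p.ετ) * ((1 - p.σ) / C)) ≤ R.τ k := by
  rw [hR.tau k]
  exact tauUpdate_spec p.σ_mem p.ετ_mem (hR.tau_prev_pos hmat k) (l1Norm_nonneg _)
    (hR.inner_g_add_max_nonpos hmat k)

theorem tau_pos (hR : IsGenerated P p K R) (hmat : MatrixAssumption P K R) (k : ℕ) :
    0 < R.τ k := (hR.tau_spec hmat k).1

theorem tau_le_init (hR : IsGenerated P p K R) (hmat : MatrixAssumption P K R) (k : ℕ) :
    R.τ k ≤ p.τinit := by
  have hε := p.ετ_mem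
  have h : ∀ k, R.τ k ≤ R.τprev p.τinit k := fun k => by
    rcases (hR.tau_spec hmat k).2.2.1 with h | h
    · exact h.le
    · exact h.trans (mul_le_of_le_one_left (hR.tau_prev_pos hmat k).le (by linarith [hε.1]))
  induction k with
  | zero => exact h 0
  | succ k ih => exact (h (k + 1)).trans ih

/-- The parameter rule gives `Δl ≥ τ max (dᵀWd) 0 + σ ‖c‖₁`. Only a fraction `θ` of the curvature is
used, small enough that the infeasibility lost in its lower bound is covered by `σ ‖c‖₁`. -/
theorem exists_isModelReductionConstant (hR : IsGenerated P p K R)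
    (hfun : FunctionAssumption P K R X) (hmat : MatrixAssumption P K R) :
    ∃ κl, IsModelReductionConstant P R κl := by
  obtain ⟨C, hC, hcurv⟩ := hR.exists_curvature_le hfun hmat
  have hζ := hmat.ζ_pos
  have hσ := p.σ_mem.1
  have hτi := p.τinit_pos
  set θ := min 1 (p.σ / (p.τinit * (C + 1))) with hθ
  have hθ0 : 0 < θ := lt_min one_pos (by positivity)
  refine ⟨θ * (K.ζ / 4), by positivity, fun k => ?_⟩
  obtain ⟨hτ, hq, -, -⟩ := hR.tau_spec hmat k
  have hτle := hR.tau_le_init hmat k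
  have hl := l1Norm_nonneg (P.c (R.x k))
  set l := l1Norm (P.c (R.x k))
  set w := inner ℝ (R.d k) (R.W P k (R.d k))
  have hmax : θ * (K.ζ / 4 * ‖R.d k‖ ^ 2 - C * l) ≤ max w 0 := by
    calc θ * (K.ζ / 4 * ‖R.d k‖ ^ 2 - C * l) ≤ θ * max w 0 :=
          mul_le_mul_of_nonneg_left ((hcurv k).trans (le_max_left _ _)) hθ0.le
      _ ≤ max w 0 := mul_le_of_le_one_left (le_max_right _ _) (min_le_left _ _)
  have hsmall : R.τ k * θ * C ≤ p.σ := by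
    calc R.τ k * θ * C ≤ p.τinit * (p.σ / (p.τinit * (C + 1))) * (C + 1) := by
          gcongr
          · exact min_le_right _ _
          · linarith
      _ = p.σ := by field_simp
  have h1 := mul_le_mul_of_nonneg_left hmax hτ.le
  have h2 := mul_le_mul_of_nonneg_right hsmall hl
  simp only [Run.Δl, Problem.modelReduction]
  nlinarith

end IsGenerated

end ModifiedSQP

/-! ### Eventually full samples and vanishing search directions. -/

namespace ModifiedSQP

/-- The samples of iteration `k` are the full sample. -/
def Run.IsFull {n m N : ℕ} (R : Run n m N) (k : ℕ) : Prop :=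
  R.Sf k = Finset.univ ∧ R.Sg k = Finset.univ ∧ R.SH k = Finset.univ

/-- A summable relative deficit of subsets of a finite set vanishes eventually. -/
theorem eventually_eq_univ_of_summable {N : ℕ} {S : ℕ → Finset (Fin N)}
    (h : Summable fun k => ((N : ℝ) - (S k).card) / N) : ∀ᶠ k in atTop, S k = Finset.univ := by
  rcases Nat.eq_zero_or_pos N with rfl | hN
  · exact Eventually.of_forall fun k => Subsingleton.elim _ _
  · have hN' : (0 : ℝ) < N := by exact_mod_cast hN
    -- The deficit is an integer over `N`, so below `1 / N` it is zero.
    filter_upwards [h.tendsto_atTop_zero.eventually_lt_const (one_div_pos.2 hN')] with k hk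
    rw [div_lt_div_iff_of_pos_right hN'] at hk
    have h1 : N < (S k).card + 1 := by exact_mod_cast (by linarith : (N : ℝ) < (S k).card + 1)
    refine Finset.eq_univ_of_card _ (le_antisymm (Finset.card_le_univ _) ?_)
    rw [Fintype.card_fin]
    omega

theorem eventually_eq_univ_of_tendsto {N : ℕ} {S : ℕ → Finset (Fin N)}
    (h : Tendsto (fun k => (S k).card) atTop (𝓝 N)) : ∀ᶠ k in atTop, S k = Finset.univ := by
  rw [nhds_discrete, tendsto_pure] at h
  filter_upwards [h] with k hk
  exact Finset.eq_univ_of_card _ (by rw [hk, Fintype.card_fin])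

theorem exists_nonneg_lipschitz {E G : Type*} [NormedAddCommGroup E] [NormedAddCommGroup G]
    {F : E → G} {X : Set E} (h : ∃ L : ℝ, ∀ x ∈ X, ∀ z ∈ X, ‖F x - F z‖ ≤ L * ‖x - z‖) :
    ∃ L ≥ 0, ∀ x ∈ X, ∀ z ∈ X, ‖F x - F z‖ ≤ L * ‖x - z‖ := by
  obtain ⟨L, hL⟩ := h
  refine ⟨|L|, abs_nonneg L, fun x hx z hz => (hL x hx z hz).trans ?_⟩
  gcongr
  exact le_abs_self L

theorem tendsto_zero_of_decrease {Ψ e : ℕ → ℝ} {b : ℝ} (he : ∀ k, 0 ≤ e k)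
    (hdec : ∀ k, Ψ (k + 1) ≤ Ψ k - e k) (hb : ∀ k, b ≤ Ψ k) : Tendsto e atTop (𝓝 0) := by
  have hanti : Antitone Ψ := antitone_nat_of_succ_le fun k => by linarith [hdec k, he k]
  have hlim := tendsto_atTop_ciInf hanti ⟨b, by rintro _ ⟨k, rfl⟩; exact hb k⟩
  have hdiff := hlim.sub (hlim.comp (tendsto_add_atTop_nat 1))
  rw [sub_self] at hdiff
  exact squeeze_zero he (fun k => by simpa using (by linarith [hdec k] : e k ≤ Ψ k - Ψ (k + 1)))
    hdiff

/-- If backtracking did not stop at `1`, the preceding trial `α / ν` was rejected and hence exceeds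
`a`. -/
theorem IsBacktrack.bounds {ν a α : ℝ} {cond : ℝ → Prop} (h : IsBacktrack ν cond α)
    (hν : ν ∈ Set.Ioo (0 : ℝ) 1) (hcond : ∀ t, 0 < t → t ≤ 1 → t ≤ a → cond t) :
    min 1 (ν * a) ≤ α ∧ 0 < α ∧ α ≤ 1 ∧ cond α := by
  obtain ⟨j, rfl, hj, hlt⟩ := h
  refine ⟨?_, pow_pos hν.1 j, pow_le_one₀ hν.1.le hν.2.le, hj⟩
  rcases j with _ | j
  · simp
  · have hja : a < ν ^ j := not_le.1 fun hle =>
      hlt j (Nat.lt_succ_self j) (hcond _ (pow_pos hν.1 j) (pow_le_one₀ hν.1.le hν.2.le) hle)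
    rw [pow_succ']
    exact (min_le_right _ _).trans (mul_le_mul_of_nonneg_left hja.le hν.1.le)

theorem IsBacktrack.eq_one {ν α : ℝ} {cond : ℝ → Prop} (h : IsBacktrack ν cond α)
    (h1 : cond 1) : α = 1 := by
  obtain ⟨j, rfl, -, hlt⟩ := h
  rcases j with _ | j
  · simp
  · exact absurd (by simpa using h1) (hlt 0 j.succ_pos)

variable {n m N : ℕ} {P : Problem n m N} {p : Params} {K : Constants} {R : Run n m N}
  {X : Set (Vec n)}

namespace Run.IsFull

variable {k : ℕ}

theorem g_eq (h : R.IsFull k) : R.g P k = gradient P.f (R.x k) := by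
  rw [Run.g, h.2.1, P.gS_univ]

theorem H_eq (h : R.IsFull k) : R.H P k = hess P.f (R.x k) := by
  rw [Run.H, h.2.2, P.HS_univ]

theorem W_eq (h : R.IsFull k) : R.W P k = P.lagHess (hess P.f (R.x k)) (R.x k) (R.y k) := by
  rw [Run.W, h.H_eq]

theorem merit_eq (h : R.IsFull k) (x : Vec n) (τ : ℝ) :
    P.merit (R.Sf k) x τ = τ * P.f x + l1Norm (P.c x) := by
  rw [Problem.merit, h.1, P.fS_univ]

theorem εA_eq (h : R.IsFull k) (τ : ℝ) : K.εA τ (R.Sf k) (R.Sg k) = 0 := by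
  simp [Constants.εA, Constants.εf, Constants.εg, h.1, h.2.1]

end Run.IsFull

namespace IsGenerated

theorem gamma_pos (hR : IsGenerated P p K R) (k : ℕ) : 0 < R.γ k := by
  induction k with
  | zero => rw [hR.gamma_zero]; exact p.γinit_pos
  | succ k ih =>
    by_cases hlong : R.γ k < ‖R.d k‖
    · rwa [(hR.long_step k hlong).2]
    · by_cases hcl : R.ClassicalCond P p K k 1
      · rwa [(hR.short_step_classical k (not_lt.1 hlong) hcl).2]
      · rw [(hR.short_step_modified k (not_lt.1 hlong) hcl).2]
        exact mul_pos p.νγ_mem.1 ih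

/-- Moving `Jᵀ y_k` to the left makes `(d_k, y_{k+1})` the solution with right-hand side `-(g, c)`,
which is bounded; no bound on `y_k` is needed. -/
theorem exists_y_le (hR : IsGenerated P p K R) (hfun : FunctionAssumption P K R X)
    (hmat : MatrixAssumption P K R) :
    ∃ B ≥ 0, ∀ k, R.IsFull k → ‖R.y (k + 1)‖ ≤ B := by
  have hκc : 0 ≤ K.κc := (norm_nonneg _).trans (hfun.c_bdd _ (hfun.iterate_mem 0))
  have hκg : 0 ≤ K.κg := (norm_nonneg _).trans (hfun.grad_bdd _ (hfun.iterate_mem 0))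
  refine ⟨K.Λ * (K.κg + K.κc), mul_nonneg hmat.Λ_pos.le (by positivity), fun k hk => ?_⟩
  have h := hmat.norm_le k (pd (R.d k) (R.y (k + 1)))
  rw [hR.M_apply, norm_neg, hk.g_eq] at h
  refine (norm_le_norm_pd_right _ _).trans (h.trans
    (mul_le_mul_of_nonneg_left ((norm_pd_le _ _).trans ?_) hmat.Λ_pos.le))
  exact add_le_add (hfun.grad_bdd _ (hfun.iterate_mem k)) (hfun.c_bdd _ (hfun.iterate_mem k))

/-- The denominator of the trial value is at most `(B + C) ‖c‖₁`: it equals `cᵀy_{k+1}` when the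
curvature is nonnegative, and otherwise exceeds it by at most `C ‖c‖₁`. So the parameter stays away
from zero, while every change shrinks it by a fixed factor. -/
theorem exists_tau_eq (hR : IsGenerated P p K R) (hfun : FunctionAssumption P K R X)
    (hmat : MatrixAssumption P K R) (hfull : ∀ᶠ k in atTop, R.IsFull k) :
    ∃ τ > 0, ∀ᶠ k in atTop, R.τ k = τ := by
  obtain ⟨k₀, hk₀⟩ := eventually_atTop.1 hfull
  obtain ⟨B, hB, hy⟩ := hR.exists_y_le hfun hmat
  obtain ⟨C, hC, hcurv⟩ := hR.exists_curvature_le hfun hmat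
  have hε := p.ετ_mem
  have hσ := p.σ_mem
  set b := (1 - p.ετ) * ((1 - p.σ) / (B + C + 1)) with hb
  have hb0 : 0 < b :=
    mul_pos (by linarith [hε.2]) (div_pos (by linarith [hσ.2]) (by positivity))
  have hlow : ∀ k ≥ k₀, min (R.τprev p.τinit k) b ≤ R.τ k := by
    intro k hk
    refine (hR.tau_spec hmat k).2.2.2 (B + C + 1) (by positivity) ?_
    have h1 := hR.inner_g_add_curvature k
    have h2 : inner ℝ (P.c (R.x k)) (R.y (k + 1)) ≤ B * l1Norm (P.c (R.x k)) := by
      refine (real_inner_le_norm _ _).trans ?_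
      rw [mul_comm]
      exact mul_le_mul (hy k (hk₀ k hk)) (norm_le_l1Norm _) (norm_nonneg _) hB
    have h3 := hcurv k
    have h4 : 0 ≤ K.ζ / 4 * ‖R.d k‖ ^ 2 := by have := hmat.ζ_pos; positivity
    have hl := l1Norm_nonneg (P.c (R.x k))
    have hCl := mul_nonneg hC hl
    rcases max_cases (inner ℝ (R.d k) (R.W P k (R.d k))) 0 with ⟨h, -⟩ | ⟨h, -⟩ <;> rw [h] <;>
      linarith
  have hmin : ∀ j, min (R.τ k₀) b ≤ R.τ (k₀ + j) := by
    intro j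
    induction j with
    | zero => exact min_le_left _ _
    | succ j ih => exact (le_min ih (min_le_right _ _)).trans (hlow (k₀ + j + 1) (by omega))
  obtain ⟨k₁, hk₁⟩ := eventually_const_of_shrink (u := fun j => R.τ (k₀ + j)) (r := 1 - p.ετ)
    (by linarith [hε.1]) (lt_min (hR.tau_pos hmat k₀) hb0) hmin
    (fun j => (hR.tau_spec hmat (k₀ + j + 1)).2.2.1)
  refine ⟨R.τ (k₀ + k₁), hR.tau_pos hmat _, eventually_atTop.2 ⟨k₀ + k₁, fun k hk => ?_⟩⟩
  have := hk₁ (k - k₀) (by omega)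
  rwa [show k₀ + (k - k₀) = k by omega] at this

/-- First-order upper bound for the merit function along the search direction. -/
theorem exists_merit_le (hR : IsGenerated P p K R) (hfun : FunctionAssumption P K R X)
    (hmat : MatrixAssumption P K R) :
    ∃ B ≥ 0, ∀ k, R.IsFull k → ∀ α, 0 ≤ α → α ≤ 1 →
      P.merit (R.Sf k) (R.x k + α • R.d k) (R.τ k)
        ≤ P.merit (R.Sf k) (R.x k) (R.τ k) - α * R.Δl P k + B * α ^ 2 * ‖R.d k‖ ^ 2 := by
  obtain ⟨L, hL, hgrad⟩ := exists_nonneg_lipschitz hfun.grad_lip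
  obtain ⟨Γ, hΓ, hJ⟩ := exists_nonneg_lipschitz hfun.J_lip
  have hτi := p.τinit_pos
  refine ⟨p.τinit * L + m * Γ, by positivity, fun k hk α h0 h1 => ?_⟩
  have hx := hfun.iterate_mem k
  have hmem : R.x k + α • R.d k ∈ X := by
    refine hfun.convex.segment_subset hx (hfun.trial_mem k) ⟨1 - α, α, by linarith, h0, by ring, ?_⟩
    module
  have hf := norm_taylor_one_le (P.contDiff_f.differentiable (by norm_num)) hfun.convex hL
    (fun x hx z hz => by rw [← norm_gradient_sub]; exact hgrad x hx z hz) hx hmem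
  have hc := norm_taylor_one_le P.differentiable_c hfun.convex hΓ hJ hx hmem
  rw [← inner_gradient_left, Real.norm_eq_abs, inner_smul_right] at hf
  have hnorm : ‖α • R.d k‖ ^ 2 = α ^ 2 * ‖R.d k‖ ^ 2 := by
    rw [norm_smul, mul_pow, Real.norm_eq_abs, sq_abs]
  rw [hnorm] at hf hc
  have hJd : fderiv ℝ P.c (R.x k) (α • R.d k) = -(α • P.c (R.x k)) := by
    rw [map_smul, ← smul_neg, ← hR.J_apply_d]; rfl
  -- The linearized constraint is scaled by exactly `1 - α`; the rest is a Taylor remainder.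
  have hl : l1Norm (P.c (R.x k + α • R.d k))
      ≤ (1 - α) * l1Norm (P.c (R.x k)) + m * (Γ * (α ^ 2 * ‖R.d k‖ ^ 2)) := by
    have : P.c (R.x k + α • R.d k) = (1 - α) • P.c (R.x k)
        + (P.c (R.x k + α • R.d k) - P.c (R.x k) - fderiv ℝ P.c (R.x k) (α • R.d k)) := by
      rw [hJd]; module
    rw [this]
    refine (l1Norm_add_le _ _).trans (add_le_add ?_ ((l1Norm_le _).trans ?_))
    · rw [l1Norm_smul, abs_of_nonneg (by linarith)]
    · gcongr
  have hτ := hR.tau_pos hmat k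
  have hτle := hR.tau_le_init hmat k
  have h2 := mul_le_mul_of_nonneg_left (le_of_abs_le hf) hτ.le
  have h3 : R.τ k * (L * (α ^ 2 * ‖R.d k‖ ^ 2)) ≤ p.τinit * (L * (α ^ 2 * ‖R.d k‖ ^ 2)) := by
    gcongr
  rw [hk.merit_eq, hk.merit_eq, Run.Δl, Problem.modelReduction, hk.g_eq]
  linarith

theorem exists_alpha_ge (hR : IsGenerated P p K R) (hfun : FunctionAssumption P K R X)
    (hmat : MatrixAssumption P K R) {κl : ℝ} (hκl : IsModelReductionConstant P R κl)
    (hfull : ∀ᶠ k in atTop, R.IsFull k) :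
    ∃ a > 0, ∀ᶠ k in atTop, a ≤ R.α k ∧ R.α k ≤ 1 ∧
      ((R.γ (k + 1) = R.γ k ∧ R.ClassicalCond P p K k (R.α k)) ∨
        (R.γ (k + 1) = p.νγ * R.γ k ∧ ‖R.d k‖ ≤ R.γ k ∧ R.ModifiedCond P p K k (R.α k))) := by
  obtain ⟨τ, hτ, hτk⟩ := hR.exists_tau_eq hfun hmat hfull
  obtain ⟨B, hB, hmerit⟩ := hR.exists_merit_le hfun hmat
  have hη := p.η_mem
  have hκH : 0 ≤ K.κH := (norm_nonneg _).trans (hfun.hess_bdd _ (hfun.iterate_mem 0))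
  have hκ := hκl.1
  -- The `κH` term makes the threshold `a` valid for the modified condition too, whose Hessian term
  -- may be negative; the `1` keeps `D` positive.
  set D := B + 1 / 2 * τ * K.κH + 1 with hD
  have hD0 : 0 < D := by positivity
  set a := (1 - p.η) * κl * τ / D with ha
  have ha0 : 0 < a := div_pos (mul_pos (mul_pos (by linarith [hη.2]) hκ) hτ) hD0
  have hν := p.να_mem
  refine ⟨min 1 (p.να * a), lt_min one_pos (mul_pos hν.1 ha0), ?_⟩
  filter_upwards [hfull, hτk] with k hk hτk
  have hdec : ∀ t, 0 < t → t ≤ 1 → t ≤ a →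
      P.merit (R.Sf k) (R.x k + t • R.d k) (R.τ k)
        ≤ P.merit (R.Sf k) (R.x k) (R.τ k) - p.η * t * R.Δl P k
          - 1 / 2 * t ^ 2 * τ * K.κH * ‖R.d k‖ ^ 2 := by
    intro t ht0 ht1 hta
    have h1 := hmerit k hk t ht0.le ht1
    have h2 : (1 - p.η) * (κl * τ * ‖R.d k‖ ^ 2) ≤ (1 - p.η) * R.Δl P k := by
      have := hκl.2 k
      rw [hτk] at this
      exact mul_le_mul_of_nonneg_left this (by linarith [hη.2])
    have h3 : t * D ≤ (1 - p.η) * κl * τ := by rwa [ha, le_div_iff₀ hD0] at hta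
    have h4 : t * D * ‖R.d k‖ ^ 2 ≤ (1 - p.η) * R.Δl P k :=
      (mul_le_mul_of_nonneg_right h3 (sq_nonneg _)).trans (by linarith)
    have h5 := mul_le_mul_of_nonneg_left h4 ht0.le
    have h6 : 0 ≤ t ^ 2 * ‖R.d k‖ ^ 2 := by positivity
    rw [hD] at h5
    nlinarith
  have hclass : ∀ t, 0 < t → t ≤ 1 → t ≤ a → R.ClassicalCond P p K k t := by
    intro t ht0 ht1 hta
    have h1 := hdec t ht0 ht1 hta
    have h2 : 0 ≤ 1 / 2 * t ^ 2 * τ * K.κH * ‖R.d k‖ ^ 2 := by positivity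
    rw [Run.ClassicalCond, hk.εA_eq]
    linarith
  have hmod : ∀ t, 0 < t → t ≤ 1 → t ≤ a → R.ModifiedCond P p K k t := by
    intro t ht0 ht1 hta
    have h1 := hdec t ht0 ht1 hta
    have h2 : -(K.κH * ‖R.d k‖ ^ 2) ≤ inner ℝ (R.d k) (R.H P k (R.d k)) := by
      refine neg_le_of_abs_le ((abs_real_inner_le_norm _ _).trans ?_)
      rw [hk.H_eq]
      have := (hess P.f (R.x k)).le_of_opNorm_le (hfun.hess_bdd _ (hfun.iterate_mem k)) (R.d k)
      nlinarith [norm_nonneg (R.d k)]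
    have h3 := mul_le_mul_of_nonneg_left h2 (by positivity : 0 ≤ 1 / 2 * t ^ 2 * τ)
    have h4 : 0 ≤ ∑ i, |inner ℝ (R.d k) (P.hessC i (R.x k) (R.d k))| :=
      Finset.sum_nonneg fun _ _ => abs_nonneg _
    have h5 := mul_nonneg (by positivity : 0 ≤ 1 / 2 * t ^ 2) h4
    rw [Run.ModifiedCond, hk.εA_eq]
    rw [hτk] at h1 ⊢
    linarith
  by_cases hlong : R.γ k < ‖R.d k‖
  · obtain ⟨hbt, hγ⟩ := hR.long_step k hlong
    obtain ⟨h1, -, h3, h4⟩ := hbt.bounds hν hclass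
    exact ⟨h1, h3, .inl ⟨hγ, h4⟩⟩
  · by_cases hcl : R.ClassicalCond P p K k 1
    · obtain ⟨hα, hγ⟩ := hR.short_step_classical k (not_lt.1 hlong) hcl
      rw [hα]
      exact ⟨min_le_left _ _, le_rfl, .inl ⟨hγ, hcl⟩⟩
    · obtain ⟨hbt, hγ⟩ := hR.short_step_modified k (not_lt.1 hlong) hcl
      obtain ⟨h1, -, h3, h4⟩ := hbt.bounds hν hmod
      exact ⟨h1, h3, .inr ⟨hγ, not_lt.1 hlong, h4⟩⟩

/-- The potential is the merit function plus `C * γ_k ^ 2`. It drops by at least a multiple of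
`‖d_k‖ ^ 2` at every late iteration and is bounded below. -/
theorem tendsto_d (hR : IsGenerated P p K R) (hfun : FunctionAssumption P K R X)
    (hmat : MatrixAssumption P K R) {κl : ℝ} (hκl : IsModelReductionConstant P R κl)
    (hfull : ∀ᶠ k in atTop, R.IsFull k) : Tendsto (fun k => ‖R.d k‖) atTop (𝓝 0) := by
  obtain ⟨τ, hτ, hτk⟩ := hR.exists_tau_eq hfun hmat hfull
  obtain ⟨a, ha, hα⟩ := hR.exists_alpha_ge hfun hmat hκl hfull
  obtain ⟨Γ, hΓ, hJ⟩ := exists_nonneg_lipschitz hfun.J_lip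
  have hκH : 0 ≤ K.κH := (norm_nonneg _).trans (hfun.hess_bdd _ (hfun.iterate_mem 0))
  have hν := p.νγ_mem
  have hη := p.η_mem
  have hquad : ∀ (A : Vec n →L[ℝ] Vec n) (C : ℝ) (d : Vec n), ‖A‖ ≤ C →
      |inner ℝ d (A d)| ≤ C * ‖d‖ ^ 2 := fun A C d hA => by
    have := A.le_of_opNorm_le hA d
    exact (abs_real_inner_le_norm _ _).trans (by nlinarith [norm_nonneg d])
  have hhessC : ∀ i k, ‖P.hessC i (R.x k)‖ ≤ Γ := fun i k =>
    norm_hess_le_of_lipschitz (P.contDiff_c_apply i) hfun.isOpen hΓ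
      (fun x hx z hz => (P.norm_gradient_c_sub_le i x z).trans (hJ x hx z hz))
      (hfun.iterate_mem k)
  have hν2 : 0 < 1 - p.νγ ^ 2 := by nlinarith [hν.1, hν.2]
  -- Chosen so that the drop of `C * γ ^ 2` under `γ ↦ νγ * γ` equals the largest second-order
  -- allowance of the modified condition when `‖d‖ ≤ γ`.
  set C := 1 / 2 * (τ * K.κH + m * Γ) / (1 - p.νγ ^ 2) with hC
  have hC0 : 0 ≤ C := by positivity
  set φ : ℕ → ℝ := fun k => τ * P.f (R.x k) + l1Norm (P.c (R.x k)) + C * R.γ k ^ 2 with hφ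
  obtain ⟨k₀, hk₀⟩ := eventually_atTop.1 (hfull.and (hτk.and hα))
  have hstep : ∀ k ≥ k₀, φ (k + 1) ≤ φ k - p.η * R.α k * R.Δl P k := by
    intro k hk
    obtain ⟨hk, hτk, hαa, hα1, hcase⟩ := hk₀ k hk
    simp only [hφ]
    rcases hcase with ⟨hγ, hcl⟩ | ⟨hγ, hd, hmod⟩
    · rw [Run.ClassicalCond, hk.εA_eq, hk.merit_eq, hk.merit_eq, ← hR.x_succ, hτk] at hcl
      rw [hγ]
      linarith
    · rw [Run.ModifiedCond, hk.εA_eq, hk.merit_eq, hk.merit_eq, ← hR.x_succ, hτk, hk.H_eq] at hmod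
      have h1 := le_of_abs_le (hquad _ _ (R.d k) (hfun.hess_bdd _ (hfun.iterate_mem k)))
      have h2 : ∑ i, |inner ℝ (R.d k) (P.hessC i (R.x k) (R.d k))| ≤ m * (Γ * ‖R.d k‖ ^ 2) := by
        refine (Finset.sum_le_sum fun i _ => hquad _ _ (R.d k) (hhessC i k)).trans ?_
        simp
      have h3 : R.α k ^ 2 ≤ 1 := pow_le_one₀ (ha.le.trans hαa) hα1
      have h4 : 1 / 2 * R.α k ^ 2 * τ * inner ℝ (R.d k) (hess P.f (R.x k) (R.d k))
          + 1 / 2 * R.α k ^ 2 * ∑ i, |inner ℝ (R.d k) (P.hessC i (R.x k) (R.d k))|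
          ≤ 1 / 2 * (τ * K.κH + m * Γ) * ‖R.d k‖ ^ 2 := by
        calc _ ≤ 1 / 2 * R.α k ^ 2 * τ * (K.κH * ‖R.d k‖ ^ 2)
              + 1 / 2 * R.α k ^ 2 * (m * (Γ * ‖R.d k‖ ^ 2)) := by gcongr
          _ = R.α k ^ 2 * (1 / 2 * (τ * K.κH + m * Γ) * ‖R.d k‖ ^ 2) := by ring
          _ ≤ _ := mul_le_of_le_one_left (by positivity) h3
      have h5 : 1 / 2 * (τ * K.κH + m * Γ) * ‖R.d k‖ ^ 2
          ≤ 1 / 2 * (τ * K.κH + m * Γ) * R.γ k ^ 2 := by gcongr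
      have h6 : C * (R.γ k ^ 2 - (p.νγ * R.γ k) ^ 2)
          = 1 / 2 * (τ * K.κH + m * Γ) * R.γ k ^ 2 := by
        rw [hC]; field_simp
      rw [hγ]
      linarith
  have hΔ : ∀ k ≥ k₀, κl * τ * ‖R.d k‖ ^ 2 ≤ R.Δl P k := fun k hk => by
    rw [← (hk₀ k hk).2.1]; exact hκl.2 k
  have hκ := hκl.1
  have hηp := hη.1
  have hlower : ∀ k ≥ k₀, p.η * a * (κl * τ) * ‖R.d k‖ ^ 2 ≤ p.η * R.α k * R.Δl P k := by
    intro k hk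
    have h0 : 0 ≤ κl * τ * ‖R.d k‖ ^ 2 := by positivity
    calc _ = p.η * a * (κl * τ * ‖R.d k‖ ^ 2) := by ring
      _ ≤ _ := mul_le_mul (mul_le_mul_of_nonneg_left (hk₀ k hk).2.2.1 hηp.le) (hΔ k hk) h0
        (mul_nonneg hηp.le (ha.le.trans (hk₀ k hk).2.2.1))
  have hlim : Tendsto (fun j => p.η * a * (κl * τ) * ‖R.d (j + k₀)‖ ^ 2) atTop (𝓝 0) := by
    refine tendsto_zero_of_decrease (Ψ := fun j => φ (j + k₀)) (b := -(τ * K.κf))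
      (fun j => by positivity) (fun j => ?_) (fun j => ?_)
    · have h1 := hstep (j + k₀) (by omega)
      have h2 := hlower (j + k₀) (by omega)
      simp only [show j + 1 + k₀ = j + k₀ + 1 by omega]
      linarith
    · have h1 := neg_le_of_abs_le (hfun.f_bdd _ (hfun.iterate_mem (j + k₀)))
      have h2 := mul_le_mul_of_nonneg_left h1 hτ.le
      have h3 := l1Norm_nonneg (P.c (R.x (j + k₀)))
      have h4 := mul_nonneg hC0 (sq_nonneg (R.γ (j + k₀)))
      simp only [hφ]
      linarith
  have hlim2 := hlim.const_mul (p.η * a * (κl * τ))⁻¹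
  have hne : p.η * a * (κl * τ) ≠ 0 := by positivity
  simp only [inv_mul_cancel_left₀ hne, mul_zero] at hlim2
  have hlim3 := ((tendsto_add_atTop_iff_nat (f := fun k => ‖R.d k‖ ^ 2) k₀).1 hlim2).sqrt
  simpa using hlim3

end IsGenerated

end ModifiedSQP

/-! ### Convergence to the solution, unit steps and the superlinear rate. -/

namespace ModifiedSQP

theorem convergesRSuperlinearly_of_eventually_le {E : Type*} [NormedAddCommGroup E] {u : ℕ → E}
    {l : E} (hu : Tendsto u atTop (𝓝 l))
    (h : ∀ ε > 0, ∀ᶠ k in atTop, ‖u (k + 1) - l‖ ≤ ε * ‖u k - l‖) :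
    ConvergesRSuperlinearly u l := by
  -- The errors may vanish, so the majorant is kept positive by `ξ k / (k + 1)`, whose ratio to `ξ
  -- k` still tends to zero.
  set ξ : ℕ → ℝ := fun k => Nat.rec (‖u 0 - l‖ + 1) (fun k z => max ‖u (k + 1) - l‖ (z / (k + 1))) k
  have hsucc : ∀ k, ξ (k + 1) = max ‖u (k + 1) - l‖ (ξ k / (k + 1)) := fun k => rfl
  have hpos : ∀ k, 0 < ξ k := by
    intro k
    induction k with
    | zero => exact add_pos_of_nonneg_of_pos (norm_nonneg _) one_pos
    | succ k ih => rw [hsucc]; exact lt_max_of_lt_right (by positivity)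
  have hle : ∀ k, ‖u k - l‖ ≤ ξ k := by
    rintro (_ | k)
    · exact le_add_of_nonneg_right zero_le_one
    · rw [hsucc]; exact le_max_left _ _
  refine ⟨hu, ξ, hpos, hle, ?_⟩
  rw [Metric.tendsto_atTop']
  intro ε hε
  obtain ⟨k₀, hk₀⟩ := eventually_atTop.1 ((h (ε / 2) (half_pos hε)).and
    (tendsto_one_div_add_atTop_nhds_zero_nat.eventually_lt_const (half_pos hε)))
  refine ⟨k₀, fun k hk => ?_⟩
  obtain ⟨h1, h2⟩ := hk₀ k hk.le
  have hξ := hpos k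
  have : ξ (k + 1) ≤ ε / 2 * ξ k := by
    rw [hsucc]
    refine max_le (h1.trans (by gcongr; exact hle k)) ?_
    rw [div_eq_mul_one_div, mul_comm]
    gcongr
  rw [Real.dist_eq, sub_zero, abs_of_pos (div_pos (hpos (k + 1)) hξ), div_lt_iff₀ hξ]
  nlinarith

variable {n m N : ℕ} {P : Problem n m N} {p : Params} {K : Constants} {R : Run n m N}
  {X : Set (Vec n)} {xs : Vec n} {ys : Vec m}

theorem tendsto_of_tendsto_w (hw : Tendsto R.w atTop (𝓝 (pd xs ys))) :
    Tendsto R.x atTop (𝓝 xs) ∧ Tendsto R.y atTop (𝓝 ys) := by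
  have hw' : Tendsto (fun k => ‖pd (R.x k - xs) (R.y k - ys)‖) atTop (𝓝 0) :=
    tendsto_iff_norm_sub_tendsto_zero.1 hw
  exact ⟨tendsto_iff_norm_sub_tendsto_zero.2
      (squeeze_zero (fun _ => norm_nonneg _) (fun k => norm_le_norm_pd_left _ _) hw'),
    tendsto_iff_norm_sub_tendsto_zero.2
      (squeeze_zero (fun _ => norm_nonneg _) (fun k => norm_le_norm_pd_right _ _) hw')⟩

namespace IsGenerated

/-- The residual at `k + 1` is small: its dual part differs from `-W_k d_k` by the change of `∇f`
and `J` over one step, and its primal part is `-J_{k+1} d_{k+1}`. The error bound applies once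
`‖d_{k+1}‖ ≤ κd`. -/
theorem tendsto_w (hR : IsGenerated P p K R) (hfun : FunctionAssumption P K R X)
    (hmat : MatrixAssumption P K R) (herr : ErrorBoundAssumption P K R xs ys) {κl : ℝ}
    (hκl : IsModelReductionConstant P R κl) (hfull : ∀ᶠ k in atTop, R.IsFull k) :
    Tendsto R.w atTop (𝓝 (pd xs ys)) := by
  have hd := hR.tendsto_d hfun hmat hκl hfull
  obtain ⟨a, ha, hα⟩ := hR.exists_alpha_ge hfun hmat hκl hfull
  obtain ⟨B, hB, hy⟩ := hR.exists_y_le hfun hmat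
  obtain ⟨L, hL, hgrad⟩ := exists_nonneg_lipschitz hfun.grad_lip
  obtain ⟨Γ, hΓ, hJ⟩ := exists_nonneg_lipschitz hfun.J_lip
  obtain ⟨Bj, hBj⟩ := hfun.J_bdd
  have hμ := herr.μM_pos
  have hd1 := hd.comp (tendsto_add_atTop_nat 1)
  have hlim : Tendsto (fun k => 2 / K.μM * ((L + Γ * B + K.κW) * ‖R.d k‖ + Bj * ‖R.d (k + 1)‖))
      atTop (𝓝 0) := by
    simpa using ((hd.const_mul (L + Γ * B + K.κW)).add (hd1.const_mul Bj)).const_mul (2 / K.μM)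
  rw [← tendsto_add_atTop_iff_nat 1, tendsto_iff_norm_sub_tendsto_zero]
  refine squeeze_zero' (Eventually.of_forall fun k => norm_nonneg _) ?_ hlim
  filter_upwards [hfull, hα, (tendsto_add_atTop_nat 1).eventually hfull,
    hd1.eventually_le_const herr.κd_pos] with k hk hα hk1 hdk
  have hres := herr.bound (k + 1) (R.d (k + 1)) (R.δ (k + 1))
    (by rw [← hk1.W_eq, ← hk1.g_eq]; exact hR.direction (k + 1)) hdk
  have hx := hfun.iterate_mem k
  have hx1 := hfun.iterate_mem (k + 1)
  have hstep : ‖R.x (k + 1) - R.x k‖ ≤ ‖R.d k‖ := by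
    rw [hR.x_succ, add_sub_cancel_left, norm_smul, Real.norm_eq_abs,
      abs_of_nonneg (ha.le.trans hα.1)]
    exact mul_le_of_le_one_left (norm_nonneg _) hα.2.1
  have hdual : gradient P.f (R.x (k + 1)) + P.Jt (R.x (k + 1)) (R.y (k + 1))
      = (gradient P.f (R.x (k + 1)) - gradient P.f (R.x k))
        + (P.Jt (R.x (k + 1)) (R.y (k + 1)) - P.Jt (R.x k) (R.y (k + 1)))
        - R.W P k (R.d k) := by
    have := hR.W_apply_d k
    rw [hk.g_eq] at this
    rw [eq_sub_of_add_eq this]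
    abel
  have h1 : ‖gradient P.f (R.x (k + 1)) - gradient P.f (R.x k)‖ ≤ L * ‖R.d k‖ :=
    (hgrad _ hx1 _ hx).trans (by gcongr)
  have h2 : ‖P.Jt (R.x (k + 1)) (R.y (k + 1)) - P.Jt (R.x k) (R.y (k + 1))‖
      ≤ Γ * ‖R.d k‖ * B := by
    refine (P.norm_Jt_sub_apply_le _ _ _).trans ?_
    have := (hJ _ hx1 _ hx).trans (mul_le_mul_of_nonneg_left hstep hΓ)
    gcongr
    exact hy k hk
  have h3 := (R.W P k).le_of_opNorm_le (hmat.W_bdd k) (R.d k)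
  have h4 : ‖P.c (R.x (k + 1))‖ ≤ Bj * ‖R.d (k + 1)‖ := by
    rw [← norm_neg, ← hR.J_apply_d]
    exact (P.J (R.x (k + 1))).le_of_opNorm_le (hBj _ hx1) _
  have h5 : ‖P.residual (gradient P.f (R.x (k + 1))) (R.x (k + 1)) (R.y (k + 1))‖
      ≤ (L + Γ * B + K.κW) * ‖R.d k‖ + Bj * ‖R.d (k + 1)‖ := by
    refine (norm_pd_le _ _).trans (add_le_add ?_ h4)
    rw [hdual]
    refine (norm_sub_le _ _).trans ((add_le_add ((norm_add_le _ _).trans (add_le_add h1 h2))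
      h3).trans (le_of_eq (by ring)))
  rw [div_mul_eq_mul_div, le_div_iff₀ hμ]
  linarith

/-- The error of a full primal-dual step, in terms of the linearization at `(xs, ys)`. -/
theorem M_apply_step_sub (hR : IsGenerated P p K R) {k : ℕ} (hk : R.IsFull k) :
    R.M P k (pd (R.x k + R.d k) (R.y (k + 1)) - pd xs ys)
      = pd ((R.W P k - P.lagHess (hess P.f xs) xs ys) (R.x k - xs)
          - (gradient P.f (R.x k) + P.Jt (R.x k) ys
            - P.lagHess (hess P.f xs) xs ys (R.x k - xs)))
        ((P.J (R.x k) - P.J xs) (R.x k - xs)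
          - (P.c (R.x k) - P.J xs (R.x k - xs))) := by
  have h1 := hR.W_apply_d k
  rw [hk.g_eq] at h1
  rw [pd_sub, Run.M, Problem.kkt_pd, pd_inj]
  -- The identity is algebraic and holds for any operator in place of the Hessian at the solution.
  generalize P.lagHess (hess P.f xs) xs ys = G
  constructor
  · rw [add_sub_right_comm, map_add, map_sub (P.Jt (R.x k)), sub_apply,
      eq_sub_of_add_eq h1]
    abel
  · rw [add_sub_right_comm, map_add, hR.J_apply_d, sub_apply]
    abel

/-- A full primal-dual step reduces the distance to the solution superlinearly, even in terms of
the primal distance alone. -/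
theorem eventually_norm_step_le (hR : IsGenerated P p K R) (hmat : MatrixAssumption P K R)
    (hs : P.IsStationary xs ys) (hfull : ∀ᶠ k in atTop, R.IsFull k)
    (hw : Tendsto R.w atTop (𝓝 (pd xs ys))) {ε : ℝ} (hε : 0 < ε) :
    ∀ᶠ k in atTop, ‖pd (R.x k + R.d k) (R.y (k + 1)) - pd xs ys‖ ≤ ε * ‖R.x k - xs‖ := by
  obtain ⟨hx, hy⟩ := tendsto_of_tendsto_w hw
  have hΛ := hmat.Λ_pos
  -- Four error terms, each at most `ε' * ‖x_k - xs‖`, are multiplied by `Λ`.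
  obtain ⟨ε', hε'⟩ : ∃ ε', ε' = ε / (4 * K.Λ) := ⟨_, rfl⟩
  have hε0 : 0 < ε' := by rw [hε']; positivity
  have hW : Tendsto (fun k => P.lagHess (hess P.f (R.x k)) (R.x k) (R.y k)) atTop
      (𝓝 (P.lagHess (hess P.f xs) xs ys)) :=
    P.tendsto_lagHess hx hy
  have hJ : Tendsto (fun k => P.J (R.x k)) atTop (𝓝 (P.J xs)) :=
    (P.continuous_J.tendsto xs).comp hx
  obtain ⟨hs1, hs2⟩ := hs
  rw [P.gradient_lagrangian_left] at hs1
  have hG : ∀ᶠ k in atTop, ‖gradient P.f (R.x k) + P.Jt (R.x k) ys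
      - P.lagHess (hess P.f xs) xs ys (R.x k - xs)‖ ≤ ε' * ‖R.x k - xs‖ := by
    have h := hx.eventually ((P.hasFDerivAt_gradient_add_Jt xs ys).isLittleO.bound hε0)
    simpa only [hs1, sub_zero] using h
  have hc : ∀ᶠ k in atTop, ‖P.c (R.x k) - P.J xs (R.x k - xs)‖ ≤ ε' * ‖R.x k - xs‖ := by
    have h := hx.eventually ((P.differentiable_c xs).hasFDerivAt.isLittleO.bound hε0)
    simp only [hs2, sub_zero] at h
    exact h
  filter_upwards [hfull, (tendsto_iff_norm_sub_tendsto_zero.1 hW).eventually_le_const hε0,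
    (tendsto_iff_norm_sub_tendsto_zero.1 hJ).eventually_le_const hε0, hG, hc]
    with k hk hW hJ hG hc
  rw [← hk.W_eq] at hW
  have hM := hR.M_apply_step_sub hk (xs := xs) (ys := ys)
  have h := hmat.norm_le k (pd (R.x k + R.d k) (R.y (k + 1)) - pd xs ys)
  rw [hM] at h
  have h1 := norm_sub_le_of_le (ContinuousLinearMap.le_of_opNorm_le _ hW (R.x k - xs)) hG
  have h2 := norm_sub_le_of_le (ContinuousLinearMap.le_of_opNorm_le _ hJ (R.x k - xs)) hc
  refine h.trans ((mul_le_mul_of_nonneg_left ((norm_pd_le _ _).trans (add_le_add h1 h2))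
    hΛ.le).trans (le_of_eq ?_))
  rw [hε']
  field_simp
  ring

/-- The second-order terms of the objective and constraints are already on the right-hand side, so
only a cubic remainder is left, which `(1 - η) Δl ≥ (1 - η) κl τ ‖d‖ ^ 2` dominates for small `d`.
-/
theorem eventually_modifiedCond_one (hR : IsGenerated P p K R) (hfun : FunctionAssumption P K R X)
    (hmat : MatrixAssumption P K R) {κl : ℝ} (hκl : IsModelReductionConstant P R κl)
    (hfull : ∀ᶠ k in atTop, R.IsFull k) : ∀ᶠ k in atTop, R.ModifiedCond P p K k 1 := by
  obtain ⟨τ, hτ, hτk⟩ := hR.exists_tau_eq hfun hmat hfull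
  obtain ⟨L, hL, hhess⟩ := exists_nonneg_lipschitz hfun.hess_lip
  obtain ⟨Γ, hΓ⟩ := hfun.hessC_lip
  have hη := p.η_mem
  have hκ := hκl.1
  have hpos : 0 < (1 - p.η) * (κl * τ) := mul_pos (by linarith [hη.2]) (by positivity)
  have hlim := (hR.tendsto_d hfun hmat hκl hfull).const_mul (τ * L + m * |Γ|)
  rw [mul_zero] at hlim
  filter_upwards [hfull, hτk, hlim.eventually_le_const hpos] with k hk hτk hd
  have hx := hfun.iterate_mem k
  have hxd := hfun.trial_mem k
  have hf := le_of_abs_le (abs_taylor_two_le P.contDiff_f hfun.convex hL hhess hx hxd)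
  have hc : l1Norm (P.c (R.x k + R.d k))
      ≤ 1 / 2 * ∑ i, |inner ℝ (R.d k) (P.hessC i (R.x k) (R.d k))| + m * (|Γ| * ‖R.d k‖ ^ 3) := by
    have hi : ∀ i, |P.c (R.x k + R.d k) i|
        ≤ 1 / 2 * |inner ℝ (R.d k) (P.hessC i (R.x k) (R.d k))| + |Γ| * ‖R.d k‖ ^ 3 := by
      intro i
      have h := abs_taylor_two_le (P.contDiff_c_apply i) hfun.convex (abs_nonneg Γ)
        (fun x hx z hz => (hΓ i x hx z hz).trans (by gcongr; exact le_abs_self Γ)) hx hxd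
      rw [P.inner_gradient_c, hR.J_apply_d, PiLp.neg_apply, sub_neg_eq_add, sub_add_cancel] at h
      have h2 := abs_sub_abs_le_abs_sub (P.c (R.x k + R.d k) i)
        (1 / 2 * inner ℝ (R.d k) (P.hessC i (R.x k) (R.d k)))
      rw [abs_mul, abs_of_pos (by norm_num : (0 : ℝ) < 1 / 2)] at h2
      exact sub_le_iff_le_add'.1 (h2.trans h)
    refine (Finset.sum_le_sum fun i _ => hi i).trans (le_of_eq ?_)
    rw [Finset.sum_add_distrib, ← Finset.mul_sum]
    simp
  have h1 := mul_le_mul_of_nonneg_left hf hτ.le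
  have h2 := mul_le_mul_of_nonneg_right hd (sq_nonneg ‖R.d k‖)
  have h3 : (1 - p.η) * (κl * τ * ‖R.d k‖ ^ 2) ≤ (1 - p.η) * R.Δl P k := by
    have := hκl.2 k
    rw [hτk] at this
    exact mul_le_mul_of_nonneg_left this (by linarith [hη.2])
  have hΔ : R.Δl P k = -τ * inner ℝ (gradient P.f (R.x k)) (R.d k) + l1Norm (P.c (R.x k)) := by
    rw [Run.Δl, Problem.modelReduction, hk.g_eq, hτk]
  rw [Run.ModifiedCond, hk.εA_eq, hk.merit_eq, hk.merit_eq, hτk, hk.H_eq, one_smul]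
  nlinarith

/-- Being short is self-perpetuating: a short step is a unit step, after which `‖d‖` shrinks by at
least `νγ` and `γ` by at most `νγ`. -/
theorem eventually_alpha_eq_one (hR : IsGenerated P p K R)
    (hmod : ∀ᶠ k in atTop, R.ModifiedCond P p K k 1)
    (hd : Tendsto (fun k => ‖R.d k‖) atTop (𝓝 0))
    (hshrink : ∀ᶠ k in atTop, R.α k = 1 → ‖R.d (k + 1)‖ ≤ p.νγ * ‖R.d k‖) :
    ∀ᶠ k in atTop, R.α k = 1 := by
  obtain ⟨k₀, hk₀⟩ := eventually_atTop.1 (hmod.and hshrink)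
  have hν := p.νγ_mem
  have hstep : ∀ k ≥ k₀, ‖R.d k‖ ≤ R.γ k → R.α k = 1 ∧ ‖R.d (k + 1)‖ ≤ R.γ (k + 1) := by
    intro k hk hdk
    have h : R.α k = 1 ∧ p.νγ * R.γ k ≤ R.γ (k + 1) := by
      by_cases hcl : R.ClassicalCond P p K k 1
      · obtain ⟨hα, hγ⟩ := hR.short_step_classical k hdk hcl
        exact ⟨hα, by rw [hγ]; exact mul_le_of_le_one_left (hR.gamma_pos k).le hν.2.le⟩
      · obtain ⟨hbt, hγ⟩ := hR.short_step_modified k hdk hcl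
        exact ⟨hbt.eq_one (hk₀ k hk).1, hγ.ge⟩
    exact ⟨h.1, ((hk₀ k hk).2 h.1).trans ((mul_le_mul_of_nonneg_left hdk hν.1.le).trans h.2)⟩
  -- If all late steps were long, `γ` would stay constant and positive while `d` tends to zero.
  obtain ⟨k₁, hk₁, hdk₁⟩ : ∃ k₁ ≥ k₀, ‖R.d k₁‖ ≤ R.γ k₁ := by
    by_contra! hlong
    have hconst : ∀ k ≥ k₀, R.γ k = R.γ k₀ := by
      intro k hk
      induction k, hk using Nat.le_induction with
      | base => rfl
      | succ k hk ih => rw [(hR.long_step k (hlong k hk)).2, ih]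
    obtain ⟨k, hk, hlt⟩ :=
      ((eventually_ge_atTop k₀).and (hd.eventually_lt_const (hR.gamma_pos k₀))).exists
    exact absurd (hlong k hk) (by rw [hconst k hk]; exact hlt.not_gt)
  have hshort : ∀ k ≥ k₁, ‖R.d k‖ ≤ R.γ k := by
    intro k hk
    induction k, hk using Nat.le_induction with
    | base => exact hdk₁
    | succ k hk ih => exact (hstep k (hk₁.trans hk) ih).2
  exact eventually_atTop.2 ⟨k₁, fun k hk => (hstep k (hk₁.trans hk) (hshort k hk)).1⟩

/-- Near the solution `‖d_k‖` is comparable to `‖x_k - xs‖`. With Newton factor `νγ / 4`, the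
comparison constants give `5 / 4 * (νγ / 4) * (4 / 3) = 5 / 12 * νγ`. -/
theorem eventually_norm_d_succ_le (hR : IsGenerated P p K R)
    (hnewton : ∀ ε > 0, ∀ᶠ k in atTop,
      ‖pd (R.x k + R.d k) (R.y (k + 1)) - pd xs ys‖ ≤ ε * ‖R.x k - xs‖) :
    ∀ᶠ k in atTop, R.α k = 1 → ‖R.d (k + 1)‖ ≤ p.νγ * ‖R.d k‖ := by
  have hν := p.νγ_mem
  have h := hnewton (p.νγ / 4) (by linarith [hν.1])
  filter_upwards [h, (tendsto_add_atTop_nat 1).eventually h] with k h0 h1 hα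
  have hx : ∀ k, ‖pd (R.x k + R.d k) (R.y (k + 1)) - pd xs ys‖ ≤ p.νγ / 4 * ‖R.x k - xs‖ →
      ‖R.x k + R.d k - xs‖ ≤ p.νγ / 4 * ‖R.x k - xs‖ := fun k hk =>
    (norm_le_norm_pd_left _ (R.y (k + 1) - ys)).trans hk
  have e0 := hx k h0
  have e1 := hx (k + 1) h1
  have h2 : ‖R.x k - xs‖ ≤ ‖R.x k + R.d k - xs‖ + ‖R.d k‖ := by
    simpa [add_sub_right_comm] using norm_sub_le (R.x k + R.d k - xs) (R.d k)
  have h3 : ‖R.d (k + 1)‖ ≤ ‖R.x (k + 1) + R.d (k + 1) - xs‖ + ‖R.x (k + 1) - xs‖ := by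
    simpa [add_sub_right_comm] using
      norm_sub_le (R.x (k + 1) + R.d (k + 1) - xs) (R.x (k + 1) - xs)
  have h4 : R.x (k + 1) = R.x k + R.d k := by rw [hR.x_succ, hα, one_smul]
  rw [← h4] at e0 h2
  have := norm_nonneg (R.x k - xs)
  have := norm_nonneg (R.x (k + 1) - xs)
  have := norm_nonneg (R.d k)
  have h5 : ‖R.x k - xs‖ ≤ 4 / 3 * ‖R.d k‖ := by nlinarith [hν.2]
  have h6 : ‖R.d (k + 1)‖ ≤ 5 / 4 * ‖R.x (k + 1) - xs‖ := by nlinarith [hν.2]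
  have h7 : p.νγ * ‖R.x k - xs‖ ≤ p.νγ * (4 / 3 * ‖R.d k‖) :=
    mul_le_mul_of_nonneg_left h5 hν.1.le
  have h8 := mul_nonneg hν.1.le (norm_nonneg (R.d k))
  linarith

end IsGenerated

end ModifiedSQP

theorem mainTheorem1 {n m N : ℕ} (P : ModifiedSQP.Problem n m N) (p : ModifiedSQP.Params)
    (K : ModifiedSQP.Constants) (R : ModifiedSQP.Run n m N) (X : Set (ModifiedSQP.Vec n))
    (xs : ModifiedSQP.Vec n) (ys : ModifiedSQP.Vec m)
    (hR : ModifiedSQP.IsGenerated P p K R)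
    (hfun : ModifiedSQP.FunctionAssumption P K R X)
    (hlag : ModifiedSQP.LagrangianAssumption P K xs ys)
    (hcomp : ModifiedSQP.ComponentAssumption P K X)
    (hmat : ModifiedSQP.MatrixAssumption P K R)
    (herr : ModifiedSQP.ErrorBoundAssumption P K R xs ys) :
    (∃ κl : ℝ, ModifiedSQP.IsModelReductionConstant P R κl) ∧
    ∀ κl : ℝ, ModifiedSQP.IsModelReductionConstant P R κl →
      -- summable function and gradient sample deficits
      Summable (fun k => ((N : ℝ) - (R.Sf k).card) / N) →
      Summable (fun k => ((N : ℝ) - (R.Sg k).card) / N) →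
      -- a large enough Hessian sample at every iteration
      ∀ εH : ℝ, εH < 2 * (1 - p.η) * κl →
      (∀ k, (1 - εH / (2 * (K.κ₂ + K.μ₂ * K.κH))) * N ≤ ((R.SH k).card : ℝ)) →
      -- gradient sample growth from iteration khat on
      ∀ khat : ℕ, ∀ κw : ℝ, 0 < κw → ∀ β : ℕ → ℝ,
      (∀ t, β (t + 1) < β t) → Filter.Tendsto β Filter.atTop (nhds 0) → β 1 ≤ K.ρ₀ p ^ 4 →
      (∀ t : ℕ, (1 - κw * K.ρ₀ p * β t ^ ((t : ℝ) / 2)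
          / (4 * K.Λ * (K.κ₁ + K.μ₁ * K.κg))) * N ≤ ((R.Sg (khat + t)).card : ℝ)) →
      -- Hessian sample growth from iteration khat on, capped at the full sample
      (∀ k ≥ khat, (R.SH k).card < (R.SH (k + 1)).card ∨ (R.SH (k + 1)).card = N) →
      Filter.Tendsto (fun k => (R.SH k).card) Filter.atTop (nhds N) →
      max ((8 * K.Λ * (K.κ₂ + K.μ₂ * K.κH) - K.ρ₀ p) / (8 * K.Λ * (K.κ₂ + K.μ₂ * K.κH)) * N) 1
        ≤ ((R.SH khat).card : ℝ) →
      ModifiedSQP.ConvergesRSuperlinearly R.w (ModifiedSQP.pd xs ys) ∧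
        ∃ k₁ : ℕ, ∀ k ≥ k₁, R.α k = 1 := by

  refine ⟨hR.exists_isModelReductionConstant hfun hmat, ?_⟩
  intro κl hκl hSf hSg _ _ _ _ _ _ _ _ _ _ _ _ hSH _
  have hfull : ∀ᶠ k in atTop, R.IsFull k :=
    (ModifiedSQP.eventually_eq_univ_of_summable hSf).and
      ((ModifiedSQP.eventually_eq_univ_of_summable hSg).and
        (ModifiedSQP.eventually_eq_univ_of_tendsto hSH))
  have hw := hR.tendsto_w hfun hmat herr hκl hfull
  have hnewton := fun ε (hε : 0 < ε) =>
    hR.eventually_norm_step_le hmat hlag.stationary hfull hw hε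
  have hα := hR.eventually_alpha_eq_one (hR.eventually_modifiedCond_one hfun hmat hκl hfull)
    (hR.tendsto_d hfun hmat hκl hfull) (hR.eventually_norm_d_succ_le hnewton)
  refine ⟨ModifiedSQP.convergesRSuperlinearly_of_eventually_le hw fun ε hε => ?_,
    eventually_atTop.1 hα⟩
  filter_upwards [hnewton ε hε, hα] with k hk hαk
  have hsucc : R.w (k + 1) = ModifiedSQP.pd (R.x k + R.d k) (R.y (k + 1)) := by
    rw [ModifiedSQP.Run.w, hR.x_succ, hαk, one_smul]
  rw [hsucc]
  -- The Newton bound involves only the primal error, which the full primal-dual error dominates.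
  exact hk.trans (mul_le_mul_of_nonneg_left
    (ModifiedSQP.norm_le_norm_pd_left _ (R.y k - ys)) hε.le)
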